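/- **Setting.** Inputs are finite simple undirected graphs $G=(V,E)$ with $V\neq\emptyset$ and without isolated vertices; $n=|V|$, and $d=2|E|/n$ is the average degree. The vertices are labelled by natural numbers, and $V$ is an arbitrary set of $n$ labels that is not known to the algorithm; the number $n$ is known. A (randomized, adaptive) algorithm may use internal randomness at no cost and the following queries: $\mathbf{RandVert}()$ returns a uniformly random vertex; $\mathbf{RandEdge}()$ returns a uniformly random edge; $\mathbf{RandNbr}(x)$ returns a uniformly random neighbour of $x$; $\mathbf{Degree}(x)$ returns $\deg(x)$; each of these costs $1$. In addition $\mathbf{Additive}(S)$, for a finite set $S$ of vertices, returns the number of edges with both endpoints in $S$, at cost $|S|$. This is the advanced model with $n$ known and $\mathbf{RandEdge}$ queries. In the full neighbourhood access model there is moreover the query $\mathbf{FullNbrHood}(x)$, which returns the set of all neighbours of $x$, at cost $1$. For $c\ge 1$, a number $a$ is a $c$-approximation to $d$ if $d/c\le a\le c\,d$. The number of queries of an algorithm means the total cost of its queries. **Theorem.** (a) There are constants $C$ and $k$ such that for all $n$ and all $\varepsilon\in(0,1)$ there is an algorithm in the advanced model with $\mathbf{RandEdge}$ that, on every $n$-vertex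 input graph $G$, with probability greater than $0.99$ outputs a $(1+\varepsilon)$-approximation to $d$ and makes at most $$C\,(\log n)^k\,\varepsilon^{-2}\min\!\left(d,\ (n/d)^{1/4}\right)$$ queries. In particular, there are constants $C$ and $k$ such that for all $n$ and all $\varepsilon\in(0,1)$ there is such an algorithm that, on every $n$-vertex input graph, with probability greater than $0.99$ outputs a $(1+\varepsilon)$-approximation to $d$ and makes at most $C(\log n)^k\varepsilon^{-2}n^{1/5}$ queries. (b) For all constants $c\ge 1$ and $p>1/2$ there are $\kappa>0$ and $N$ such that the following holds for all $n\ge N$. If an algorithm for $n$-vertex graphs, even with full neighbourhood access in addition to the queries of the advanced model and $\mathbf{RandEdge}$, on every $n$-vertex input graph with probability at least $p$ outputs a $c$-approximation to $d$ and makes at most $q$ queries, then $q\ge \kappa\, n^{1/5}$. -/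

import Mathlib

open scoped ENNReal

noncomputable section

namespace AvgDeg

/-- A finite nonempty simple undirected graph without isolated vertices. The vertices carry labels
from the universe `ℕ`; the vertex set `verts` is an arbitrary finite set of labels, so that an
algorithm that has to work for all such graphs does not know it in advance. -/
structure Graph where
  verts : Finset ℕ
  toSimple : SimpleGraph ℕ
  nonempty : verts.Nonempty
  mem_of_adj : ∀ x y, toSimple.Adj x y → x ∈ verts
  exists_adj : ∀ x ∈ verts, ∃ y, toSimple.Adj x y

namespace Graph

variable (G : Graph)

/-- The number of vertices. -/
def n : ℕ := G.verts.card

open Classical in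
/-- The neighbourhood of `x` (empty if `x` is not a vertex). -/
def nbrs (x : ℕ) : Finset ℕ := G.verts.filter fun y => G.toSimple.Adj x y

open Classical in
/-- The edges with both endpoints in `S`. -/
def edgesIn (S : Finset ℕ) : Finset (Sym2 ℕ) := S.sym2.filter fun e => e ∈ G.toSimple.edgeSet

/-- All edges. -/
def edges : Finset (Sym2 ℕ) := G.edgesIn G.verts

/-- The average degree `d`. -/
def avgDeg : ℝ := (∑ x ∈ G.verts, ((G.nbrs x).card : ℝ)) / (G.n : ℝ)

theorem edges_nonempty : G.edges.Nonempty := by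
  obtain ⟨x, hx⟩ := G.nonempty
  obtain ⟨y, hy⟩ := G.exists_adj x hx
  refine ⟨s(x, y), ?_⟩
  simp only [edges, edgesIn, Finset.mem_filter, Finset.mk_mem_sym2_iff, SimpleGraph.mem_edgeSet]
  exact ⟨⟨hx, G.mem_of_adj y x hy.symm⟩, hy⟩

end Graph

/-- The oracle queries. -/
inductive Query : Type
  | randVert
  | randEdge
  | randNbr (x : ℕ)
  | degree (x : ℕ)
  | additive (S : Finset ℕ)
  | fullNbr (x : ℕ)

/-- The type of the answer to a query. -/
abbrev Query.Answer : Query → Type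
  | .randVert => ℕ
  | .randEdge => Sym2 ℕ
  | .randNbr _ => ℕ
  | .degree _ => ℕ
  | .additive _ => ℕ
  | .fullNbr _ => Finset ℕ

/-- `Additive(S)` costs `|S|`, every other query has unit cost. -/
def Query.cost : Query → ℕ
  | .additive S => S.card
  | _ => 1

open Classical in
/-- The distribution of the answer to a query:
a uniform vertex; a uniform edge; a uniform neighbour of `x` (the label `x` itself is returned
exactly when `x` is not a vertex); the degree of `x`; the number of edges inside `S`;
the set of all neighbours of `x`. -/
def Graph.answer (G : Graph) : (q : Query) → PMF q.Answer
  | .randVert => PMF.uniformOfFinset G.verts G.nonempty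
  | .randEdge => PMF.uniformOfFinset G.edges G.edges_nonempty
  | .randNbr x =>
      if h : (G.nbrs x).Nonempty then PMF.uniformOfFinset (G.nbrs x) h else PMF.pure x
  | .degree x => PMF.pure (G.nbrs x).card
  | .additive S => PMF.pure (G.edgesIn S).card
  | .fullNbr x => PMF.pure (G.nbrs x)

/-- Randomized adaptive query algorithms with a real output whose queries all belong to `M`:
decision trees whose nodes either output a number, or make a free internal random choice, or
make a query and continue depending on the answer. -/
inductive Alg (M : Set Query) : Type
  | ret (r : ℝ) : Alg M
  | toss (p : PMF ℕ) (k : ℕ → Alg M) : Alg M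
  | query (q : Query) (hq : q ∈ M) (k : q.Answer → Alg M) : Alg M

/-- The joint distribution of the output and of the total query cost of an algorithm on `G`, where
the answers to the queries and the internal random choices are mutually independent. -/
def Alg.run {M : Set Query} (G : Graph) : Alg M → PMF (ℝ × ℕ)
  | .ret r => PMF.pure (r, 0)
  | .toss p k => p.bind fun i => (k i).run G
  | .query q _ k =>
      (G.answer q).bind fun a => ((k a).run G).map fun o => (o.1, o.2 + q.cost)

/-- The advanced model together with random edge samples. -/
def advancedModel : Set Query :=
  {q | match q with
    | .fullNbr _ => False
    | _ => True}

/-- The advanced model with random edge samples, strengthened by full neighbourhood access. -/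
def fullNbrModel : Set Query := Set.univ

/-- `a` is a `c`-approximation to `d`. -/
def IsApprox (c d a : ℝ) : Prop := d / c ≤ a ∧ a ≤ c * d

/-- The probability that on input `G` the algorithm `A` outputs a `c`-approximation to the average
degree of `G` at total query cost at most `q`. -/
def successProb {M : Set Query} (A : Alg M) (G : Graph) (c q : ℝ) : ℝ≥0∞ :=
  (A.run G).toOuterMeasure {o | IsApprox c G.avgDeg o.1 ∧ (o.2 : ℝ) ≤ q}

end AvgDeg

end

/-!
**Upper bound.** The scales `t = 1, 2, 4, …` are tried one after the other. At scale `t` a vertex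
is heavy if its degree exceeds `n / t ^ 3`. If `d` is at most of the order of `t`, then `1 / d`,
the mean of `1 / deg` over the tails of random half-edges, is estimated directly. Otherwise one of
two cases applies. If a constant fraction of the half-edges has two heavy ends, tails of random
half-edges weighted by `n / deg` behave like uniformly random heavy vertices, and the edges
between about `t` such tails and `t` others are counted with `Additive` through the binary digits
of the weights: the cost is linear in the number of samples, while the number of pairs, which
controls the variance, is quadratic. If instead a constant fraction of the half-edges has a light
tail, the degree of a uniformly random vertex, cut off at `n / t ^ 3`, has mean `d` times that
fraction and a small variance. An estimate is used only above a threshold at which Chebyshev's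
inequality gives relative accuracy `ε`, so wrong scales are rejected rather than answered wrongly,
and `t` of the order of `min d ((n / d) ^ (1 / 4))` succeeds.

**Lower bound.** Both inputs are disjoint unions of cliques placed in randomly permuted blocks of
a label space with many more blocks than vertices. With `n` of the order of `r ^ 5`, most vertices
are matched into pairs, while most edges lie in cliques of size `2 r ^ 2 + 1`; the two inputs have
of the order of `r ^ 2` such cliques, with numbers differing by a constant factor. Up to
probability `O(1 / r)` per unit of cost, a random vertex falls into a fresh pair, a random edge
falls into a fresh large clique, and a label not yet seen belongs to no vertex. All answers before
about `r` queries can thus be simulated without knowing the number of large cliques, and hence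
without knowing `d` up to a constant factor.
-/

open scoped ENNReal

noncomputable section

namespace AvgDeg

section Mean

variable {α β : Type}

/-- The expectation of a nonnegative function under a discrete distribution. -/
def mean (p : PMF α) (f : α → ℝ≥0∞) : ℝ≥0∞ := ∑' a, p a * f a

theorem mean_pure (a : α) (f : α → ℝ≥0∞) : mean (PMF.pure a) f = f a := by
  rw [mean, tsum_eq_single a fun b hb => by simp [PMF.pure_apply, hb]]
  simp

theorem mean_uniformOfFinset (s : Finset α) (hs : s.Nonempty) (f : α → ℝ≥0∞) :
    mean (PMF.uniformOfFinset s hs) f = (s.card : ℝ≥0∞)⁻¹ * ∑ a ∈ s, f a := by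
  rw [mean, tsum_eq_sum fun b hb => by rw [PMF.uniformOfFinset_apply_of_notMem hs hb, zero_mul],
    Finset.mul_sum]
  exact Finset.sum_congr rfl fun a ha => by rw [PMF.uniformOfFinset_apply_of_mem hs ha]

theorem mean_mono (p : PMF α) {f g : α → ℝ≥0∞} (h : ∀ a, f a ≤ g a) : mean p f ≤ mean p g :=
  ENNReal.tsum_le_tsum fun a => mul_le_mul_right (h a) _

theorem mean_const (p : PMF α) (r : ℝ≥0∞) : mean p (fun _ => r) = r := by
  rw [mean, ENNReal.tsum_mul_right, p.tsum_coe, one_mul]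

theorem mean_add (p : PMF α) (f g : α → ℝ≥0∞) :
    mean p (fun a => f a + g a) = mean p f + mean p g := by
  simp only [mean, mul_add, ENNReal.tsum_add]

theorem mean_const_mul (p : PMF α) (r : ℝ≥0∞) (f : α → ℝ≥0∞) :
    mean p (fun a => r * f a) = r * mean p f := by
  simp only [mean, mul_left_comm, ENNReal.tsum_mul_left]

theorem mean_sum {ι : Type} (p : PMF α) (s : Finset ι) (f : ι → α → ℝ≥0∞) :
    mean p (fun a => ∑ i ∈ s, f i a) = ∑ i ∈ s, mean p (f i) := by
  simp only [mean, Finset.mul_sum]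
  exact Summable.tsum_finsetSum fun _ _ => ENNReal.summable

end Mean

section HitProb

variable {M : Set Query} (G : Graph) (T : Set ℝ)

/-- The probability that on input `G` the algorithm `A` outputs an element of `T` at cost at
most `q`. -/
def hitProb (A : Alg M) (q : ℕ) : ℝ≥0∞ := (A.run G).toOuterMeasure {o | o.1 ∈ T ∧ o.2 ≤ q}

theorem hitProb_le_one (A : Alg M) (q : ℕ) : hitProb G T A q ≤ 1 := by
  rw [hitProb, PMF.toOuterMeasure_apply, ← (A.run G).tsum_coe]
  exact ENNReal.tsum_le_tsum fun o => Set.indicator_le_self _ _ o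

theorem hitProb_ne_top (A : Alg M) (q : ℕ) : hitProb G T A q ≠ ⊤ :=
  ne_top_of_le_ne_top ENNReal.one_ne_top (hitProb_le_one G T A q)

theorem hitProb_mono (A : Alg M) {q q' : ℕ} (h : q ≤ q') : hitProb G T A q ≤ hitProb G T A q' :=
  (A.run G).toOuterMeasure.mono fun _ ho => ⟨ho.1, ho.2.trans h⟩

open Classical in
theorem hitProb_ret (r : ℝ) (q : ℕ) :
    hitProb (M := M) G T (.ret r) q = if r ∈ T then 1 else 0 := by
  simp [hitProb, Alg.run, PMF.toOuterMeasure_pure_apply]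

theorem hitProb_toss (p : PMF ℕ) (k : ℕ → Alg M) (q : ℕ) :
    hitProb G T (.toss p k) q = mean p fun i => hitProb G T (k i) q := by
  simp [hitProb, mean, Alg.run, PMF.toOuterMeasure_bind_apply]

theorem hitProb_query_of_lt (x : Query) (hx : x ∈ M) (k : x.Answer → Alg M) {q : ℕ}
    (h : q < x.cost) : hitProb G T (.query x hx k) q = 0 := by
  have hempty : (fun o : ℝ × ℕ => (o.1, o.2 + x.cost)) ⁻¹' {o | o.1 ∈ T ∧ o.2 ≤ q} = ∅ := by
    ext o
    simp only [Set.mem_preimage, Set.mem_ofPred_eq, Set.mem_empty_iff_false, iff_false, not_and]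
    omega
  simp [hitProb, Alg.run, PMF.toOuterMeasure_bind_apply, PMF.toOuterMeasure_map_apply, hempty]

theorem hitProb_query_add (x : Query) (hx : x ∈ M) (k : x.Answer → Alg M) (q : ℕ) :
    hitProb G T (.query x hx k) (q + x.cost) = mean (G.answer x) fun a => hitProb G T (k a) q := by
  simp only [hitProb, mean, Alg.run, PMF.toOuterMeasure_bind_apply, PMF.toOuterMeasure_map_apply,
    Set.preimage_ofPred_eq, add_le_add_iff_right]

theorem successProb_eq_hitProb (A : Alg M) (c : ℝ) {q : ℝ} (hq : 0 ≤ q) :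
    successProb A G c q = hitProb G {a | IsApprox c G.avgDeg a} A ⌊q⌋₊ := by
  simp only [successProb, hitProb, Set.mem_ofPred_eq, Nat.le_floor_iff hq]

theorem successProb_mono (A : Alg M) (c : ℝ) {q q' : ℝ} (h : q ≤ q') :
    successProb A G c q ≤ successProb A G c q' :=
  (A.run G).toOuterMeasure.mono fun _ ho => ⟨ho.1, ho.2.trans h⟩

end HitProb

namespace Graph

variable (G : Graph)

/-- The degree of `x`. -/
def deg (x : ℕ) : ℕ := (G.nbrs x).card

open Classical in
/-- The adjacency matrix. -/
def adj (x y : ℕ) : ℝ := if G.toSimple.Adj x y then 1 else 0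

open Classical in
/-- The ordered pairs of adjacent vertices of `S`. -/
def dartsIn (S : Finset ℕ) : Finset (ℕ × ℕ) := (S ×ˢ S).filter fun p => G.toSimple.Adj p.1 p.2

open Classical in
theorem adj_comm (x y : ℕ) : G.adj x y = G.adj y x := if_congr (G.toSimple.adj_comm x y) rfl rfl

theorem adj_nonneg (x y : ℕ) : 0 ≤ G.adj x y := by unfold adj; split_ifs <;> norm_num

theorem adj_le_one (x y : ℕ) : G.adj x y ≤ 1 := by unfold adj; split_ifs <;> norm_num

theorem sum_adj (x : ℕ) : ∑ y ∈ G.verts, G.adj x y = G.deg x := by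
  simp only [adj, deg, nbrs, Finset.sum_boole]

theorem n_pos : 0 < G.n := Finset.card_pos.2 G.nonempty

open Classical in
theorem deg_le (x : ℕ) : G.deg x ≤ G.n := Finset.card_filter_le _ _

open Classical in
theorem deg_pos {x : ℕ} (hx : x ∈ G.verts) : 0 < G.deg x := by
  obtain ⟨y, hxy⟩ := G.exists_adj x hx
  exact Finset.card_pos.2 ⟨y, Finset.mem_filter.2 ⟨G.mem_of_adj y x hxy.symm, hxy⟩⟩

theorem n_mul_avgDeg : (G.n : ℝ) * G.avgDeg = ∑ x ∈ G.verts, (G.deg x : ℝ) :=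
  mul_div_cancel₀ _ (Nat.cast_ne_zero.2 G.n_pos.ne')

theorem one_le_avgDeg : 1 ≤ G.avgDeg := by
  refine (one_le_div (Nat.cast_pos.2 G.n_pos)).2 ?_
  calc (G.n : ℝ) = ∑ _x ∈ G.verts, 1 := by simp [n]
    _ ≤ ∑ x ∈ G.verts, (G.deg x : ℝ) :=
      Finset.sum_le_sum fun x hx => mod_cast G.deg_pos hx

theorem avgDeg_le : G.avgDeg ≤ G.n := by
  refine (div_le_iff₀ (Nat.cast_pos.2 G.n_pos)).2 ?_
  calc ∑ x ∈ G.verts, (G.deg x : ℝ) ≤ ∑ _x ∈ G.verts, (G.n : ℝ) :=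
        Finset.sum_le_sum fun x _ => mod_cast G.deg_le x
    _ = (G.n : ℝ) * G.n := by rw [Finset.sum_const, nsmul_eq_mul, n]

theorem two_le_n : 2 ≤ G.n := by
  obtain ⟨x, hx⟩ := G.nonempty
  obtain ⟨y, hxy⟩ := G.exists_adj x hx
  exact Finset.one_lt_card.2 ⟨x, hx, y, G.mem_of_adj y x hxy.symm, hxy.ne⟩

theorem sum_dartsIn (S : Finset ℕ) (F : ℕ × ℕ → ℝ) :
    ∑ p ∈ G.dartsIn S, F p = ∑ x ∈ S, ∑ y ∈ S, G.adj x y * F (x, y) := by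
  simp only [dartsIn, Finset.sum_filter, Finset.sum_product, adj, ite_mul, one_mul, zero_mul]

theorem mem_dartsIn {S : Finset ℕ} {p : ℕ × ℕ} :
    p ∈ G.dartsIn S ↔ (p.1 ∈ S ∧ p.2 ∈ S) ∧ G.toSimple.Adj p.1 p.2 := by
  simp only [dartsIn, Finset.mem_filter, Finset.mem_product]

theorem mk_mem_edgesIn {S : Finset ℕ} {x y : ℕ} :
    s(x, y) ∈ G.edgesIn S ↔ (x ∈ S ∧ y ∈ S) ∧ G.toSimple.Adj x y := by
  simp only [edgesIn, Finset.mem_filter, Finset.mk_mem_sym2_iff, SimpleGraph.mem_edgeSet]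

theorem sum_dartsIn_eq_sum_edgesIn (S : Finset ℕ) (F : ℕ × ℕ → ℝ) :
    ∑ p ∈ G.dartsIn S, F p = ∑ e ∈ G.edgesIn S, (F (e.inf, e.sup) + F (e.sup, e.inf)) := by
  have sum_lt (F : ℕ × ℕ → ℝ) :
      ∑ p ∈ G.dartsIn S with p.1 < p.2, F p = ∑ e ∈ G.edgesIn S, F (e.inf, e.sup) := by
    refine Finset.sum_bij' (fun p _ => s(p.1, p.2)) (fun e _ => (e.inf, e.sup)) ?_ ?_ ?_ ?_ ?_
    · rintro ⟨x, y⟩ hp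
      exact G.mk_mem_edgesIn.2 (G.mem_dartsIn.1 (Finset.mem_filter.1 hp).1)
    · intro e he
      induction e using Sym2.inductionOn with | _ x y
      obtain ⟨⟨hx, hy⟩, hxy⟩ := G.mk_mem_edgesIn.1 he
      rcases hxy.ne.lt_or_gt with h | h
      · simp [mem_dartsIn, h, h.le, hx, hy, hxy]
      · simp [mem_dartsIn, h, h.le, hx, hy, hxy.symm]
    · rintro ⟨x, y⟩ hp
      have hlt := (Finset.mem_filter.1 hp).2.le
      simp [inf_of_le_left hlt, sup_of_le_right hlt]
    · intro e _
      induction e using Sym2.inductionOn with | _ x y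
      rcases le_total x y with h | h <;> simp [h, Sym2.eq_swap]
    · rintro ⟨x, y⟩ hp
      have hlt := (Finset.mem_filter.1 hp).2.le
      simp [inf_of_le_left hlt, sup_of_le_right hlt]
  have sum_gt : ∑ p ∈ G.dartsIn S with ¬ p.1 < p.2, F p =
      ∑ p ∈ G.dartsIn S with p.1 < p.2, F p.swap := by
    refine Finset.sum_nbij' Prod.swap Prod.swap ?_ ?_ (by simp) (by simp) (by simp)
    all_goals
      rintro ⟨x, y⟩ hp
      simp only [Finset.mem_filter, mem_dartsIn, Prod.fst_swap, Prod.snd_swap] at hp ⊢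
      exact ⟨⟨hp.1.1.symm, hp.1.2.symm⟩, by have := hp.1.2.ne; omega⟩
  rw [← Finset.sum_filter_add_sum_filter_not _ fun p : ℕ × ℕ => p.1 < p.2, sum_gt, sum_lt,
    sum_lt fun p => F p.swap, Finset.sum_add_distrib]
  rfl

theorem two_mul_card_edgesIn (S : Finset ℕ) :
    2 * ((G.edgesIn S).card : ℝ) = ∑ x ∈ S, ∑ y ∈ S, G.adj x y := by
  have h := (G.sum_dartsIn S fun _ => 1).symm.trans (G.sum_dartsIn_eq_sum_edgesIn S fun _ => 1)
  simp only [mul_one, Finset.sum_const, nsmul_eq_mul] at h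
  rw [h]
  ring

theorem two_mul_card_edges : 2 * (G.edges.card : ℝ) = G.n * G.avgDeg := by
  rw [edges, two_mul_card_edgesIn, n_mul_avgDeg]
  exact Finset.sum_congr rfl fun x _ => G.sum_adj x

end Graph

/-- A positive normalized linear functional on the real functions on `α`: the expectation operator
of a finitely supported distribution. In contrast to integrals it needs no integrability. -/
structure Expectation (α : Type) where
  toLinearMap : (α → ℝ) →ₗ[ℝ] ℝ
  mono' : ∀ f g, (∀ a, f a ≤ g a) → toLinearMap f ≤ toLinearMap g
  map_one' : toLinearMap (fun _ => 1) = 1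

namespace Expectation

variable {α β γ : Type}

instance : CoeFun (Expectation α) fun _ => (α → ℝ) → ℝ := ⟨fun E => E.toLinearMap⟩

instance : Monad Expectation where
  pure a := ⟨LinearMap.proj a, fun _ _ h => h a, rfl⟩
  bind E F := ⟨E.toLinearMap ∘ₗ LinearMap.pi fun a => (F a).toLinearMap,
    fun _ _ h => E.mono' _ _ fun a => (F a).mono' _ _ h,
    (congrArg E.toLinearMap (funext fun a => (F a).map_one')).trans E.map_one'⟩

theorem pure_apply (a : α) (f : α → ℝ) : (pure a : Expectation α) f = f a := rfl

theorem bind_apply (E : Expectation α) (F : α → Expectation β) (f : β → ℝ) :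
    (E >>= F) f = E fun a => F a f := rfl

theorem map_apply (g : α → β) (E : Expectation α) (f : β → ℝ) :
    (g <$> E) f = E fun a => f (g a) := rfl

/-- The uniform distribution on `s`. -/
def unif (s : Finset α) (hs : s.Nonempty) : Expectation α where
  toLinearMap := (s.card : ℝ)⁻¹ • ∑ a ∈ s, LinearMap.proj a
  mono' f g h := by
    simp only [LinearMap.smul_apply, LinearMap.sum_apply, LinearMap.proj_apply, smul_eq_mul]
    gcongr
    exact h _
  map_one' := by
    simp [inv_mul_cancel₀ (Nat.cast_ne_zero.2 hs.card_pos.ne' : (s.card : ℝ) ≠ 0)]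

theorem unif_apply (s : Finset α) (hs : s.Nonempty) (f : α → ℝ) :
    unif s hs f = (s.card : ℝ)⁻¹ * ∑ a ∈ s, f a := by
  simp [unif]

section Linear

variable (E : Expectation α)

theorem mono {f g : α → ℝ} (h : ∀ a, f a ≤ g a) : E f ≤ E g := E.mono' f g h

theorem map_add (f g : α → ℝ) : E (fun a => f a + g a) = E f + E g := E.toLinearMap.map_add f g

theorem map_sub (f g : α → ℝ) : E (fun a => f a - g a) = E f - E g := E.toLinearMap.map_sub f g

theorem map_const_mul (r : ℝ) (f : α → ℝ) : E (fun a => r * f a) = r * E f :=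
  E.toLinearMap.map_smul r f

theorem map_div_const (f : α → ℝ) (r : ℝ) : E (fun a => f a / r) = E f / r := by
  simp only [div_eq_inv_mul, map_const_mul]

theorem map_sum {ι : Type} (s : Finset ι) (f : ι → α → ℝ) :
    E (fun a => ∑ i ∈ s, f i a) = ∑ i ∈ s, E (f i) := by
  rw [← _root_.map_sum]
  congr 1
  ext a
  rw [Finset.sum_apply]

theorem map_const (r : ℝ) : E (fun _ => r) = r := by
  simpa only [mul_one, E.map_one'] using E.map_const_mul r fun _ => 1

theorem nonneg {f : α → ℝ} (h : ∀ a, 0 ≤ f a) : 0 ≤ E f := by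
  simpa only [map_const] using E.mono h

theorem le_const {f : α → ℝ} {r : ℝ} (h : ∀ a, f a ≤ r) : E f ≤ r := by
  simpa only [map_const] using E.mono h

theorem map_sub_const_sq (f : α → ℝ) (μ : ℝ) :
    E (fun a => (f a - μ) ^ 2) = E (fun a => f a ^ 2) - 2 * μ * E f + μ ^ 2 := by
  have h : ∀ a, (f a - μ) ^ 2 = f a ^ 2 - 2 * μ * f a + μ ^ 2 := fun a => by ring
  simp only [h, map_add, map_sub, map_const_mul, map_const]

end Linear

section Prob

variable (E : Expectation α)

open Classical in
/-- The probability of an event. -/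
def prob (P : α → Prop) : ℝ := E fun a => if P a then 1 else 0

theorem prob_map (g : α → β) (P : β → Prop) : (g <$> E).prob P = E.prob fun a => P (g a) := rfl

theorem prob_mono {P Q : α → Prop} (h : ∀ a, P a → Q a) : E.prob P ≤ E.prob Q :=
  E.mono fun a => by
    by_cases hP : P a
    · simp only [hP, h a hP, if_true, le_refl]
    · rw [if_neg hP]; split_ifs <;> norm_num

theorem prob_pure (a : α) {P : α → Prop} (h : ¬ P a) : (pure a : Expectation α).prob P = 0 :=
  if_neg h

theorem prob_le_one (P : α → Prop) : E.prob P ≤ 1 :=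
  E.le_const fun a => by split_ifs <;> norm_num

theorem prob_bind_le {F : α → Expectation β} {P : α → Prop} {Q : β → Prop} {δ η : ℝ}
    (hη : 0 ≤ η) (hP : E.prob P ≤ δ) (hQ : ∀ a, ¬ P a → (F a).prob Q ≤ η) :
    (E >>= F).prob Q ≤ δ + η := by
  classical
  calc (E >>= F).prob Q = E fun a => (F a).prob Q := rfl
    _ ≤ E fun a => (if P a then 1 else 0) + η := E.mono fun a => by
      split_ifs with ha
      · linarith [(F a).prob_le_one Q]
      · linarith [hQ a ha]
    _ = E.prob P + η := by rw [map_add, map_const, prob]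
    _ ≤ δ + η := by linarith

theorem chebyshev (f : α → ℝ) (μ : ℝ) {δ v : ℝ} (hδ : 0 < δ)
    (hv : E (fun a => (f a - μ) ^ 2) ≤ v * δ ^ 2) : E.prob (fun a => δ < |f a - μ|) ≤ v := by
  have hmarkov : E.prob (fun a => δ < |f a - μ|) ≤ E fun a => (f a - μ) ^ 2 / δ ^ 2 :=
    E.mono fun a => by
      split_ifs with h
      · rw [one_le_div (by positivity), ← sq_abs (f a - μ)]
        gcongr
      · positivity
  rw [map_div_const] at hmarkov
  exact hmarkov.trans ((div_le_iff₀ (by positivity)).2 hv)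

theorem le_apply_of_prob_le {f : α → ℝ} {P : α → Prop} {δ y : ℝ} (hf : ∀ a, 0 ≤ f a)
    (hy : y ≤ 1) (hP : E.prob P ≤ δ) (h : ∀ a, ¬ P a → y ≤ f a) : y - δ ≤ E f := by
  classical
  calc y - δ ≤ y - E.prob P := by linarith
    _ = E fun a => y - if P a then 1 else 0 := by rw [map_sub, map_const, prob]
    _ ≤ E f := E.mono fun a => by
      split_ifs with ha
      · linarith [hf a]
      · simpa only [sub_zero] using h a ha

end Prob

/-- Fubini's theorem holds for `E` and `E'`. -/
def Commutes (E : Expectation α) (E' : Expectation β) : Prop :=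
  ∀ f : α → β → ℝ, E (fun a => E' fun b => f a b) = E' fun b => E fun a => f a b

theorem commutes_unif (s : Finset α) (hs : s.Nonempty) (E : Expectation β) :
    (unif s hs).Commutes E := fun f => by
  simp only [unif_apply, map_const_mul, map_sum]

end Expectation

section Sampling

variable {m : Type → Type} [Monad m] {α : Type}

/-- `N` independent samples. -/
def sample (x : m α) : (N : ℕ) → m (Fin N → α)
  | 0 => pure Fin.elim0
  | N + 1 => do
    let a ← x
    let v ← sample x N
    pure (Fin.cons a v)

/-- The average of the statistic `f` over `N` independent samples. -/
def average (f : α → ℝ) (x : m α) (N : ℕ) : m ℝ := do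
  let v ← sample x N
  pure ((∑ i, f (v i)) / N)

/-- The average of the kernel `g` over all pairs of two independent families of `N` samples. -/
def pairAverage (g : α → α → ℝ) (x : m α) (N : ℕ) : m ℝ := do
  let u ← sample x N
  let v ← sample x N
  pure ((∑ j, ∑ i, g (u i) (v j)) / N ^ 2)

end Sampling

namespace Expectation

variable {α β : Type} (E : Expectation α)

theorem sample_succ_apply (N : ℕ) (f : (Fin (N + 1) → α) → ℝ) :
    sample E (N + 1) f = E fun a => sample E N fun v => f (Fin.cons a v) := rfl

theorem sample_sum (N : ℕ) (f : α → ℝ) : sample E N (fun v => ∑ i, f (v i)) = N * E f := by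
  induction N with
  | zero => simp [map_const]
  | succ N ih =>
    simp only [sample_succ_apply, Fin.sum_univ_succ, Fin.cons_zero, Fin.cons_succ, map_add,
      map_const, ih]
    push_cast
    ring

theorem sample_sum_sq (N : ℕ) (f : α → ℝ) :
    sample E N (fun v => (∑ i, f (v i)) ^ 2) =
      N * E (fun a => f a ^ 2) + N * (N - 1) * E f ^ 2 := by
  induction N with
  | zero => simp [map_const]
  | succ N ih =>
    have hsq : ∀ x y : ℝ, (x + y) ^ 2 = x ^ 2 + 2 * x * y + y ^ 2 := fun x y => by ring
    simp only [sample_succ_apply, Fin.sum_univ_succ, Fin.cons_zero, Fin.cons_succ, hsq, map_add,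
      map_const, map_const_mul, ih, sample_sum]
    have hcross : ∀ a, 2 * f a * (N * E f) = 2 * (N * E f) * f a := fun a => by ring
    simp only [hcross, map_const_mul]
    push_cast
    ring

theorem sample_sum_sq_le (N : ℕ) (f : α → ℝ) :
    sample E N (fun v => (∑ i, f (v i)) ^ 2) ≤
      N * E (fun a => f a ^ 2) + (N * E f) ^ 2 := by
  rw [sample_sum_sq]
  nlinarith [mul_nonneg N.cast_nonneg (sq_nonneg (E f))]

theorem average_apply (f : α → ℝ) (N : ℕ) (φ : ℝ → ℝ) :
    average f E N φ = sample E N fun v => φ ((∑ i, f (v i)) / N) := rfl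

theorem average_sub_sq_le (f : α → ℝ) {N : ℕ} (hN : 0 < N) :
    average f E N (fun x => (x - E f) ^ 2) ≤ E (fun a => f a ^ 2) / N := by
  rw [average_apply, map_sub_const_sq]
  simp only [div_pow, map_div_const, sample_sum]
  have h : sample E N (fun v => (∑ i, f (v i)) ^ 2) / (N : ℝ) ^ 2 ≤
      E (fun a => f a ^ 2) / N + E f ^ 2 := by
    rw [div_le_iff₀ (by positivity)]
    refine (E.sample_sum_sq_le N f).trans (le_of_eq ?_)
    field_simp
  have hmean : (N : ℝ) * E f / N = E f := by field_simp
  rw [hmean]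
  linarith

theorem prob_average_le (f : α → ℝ) {N : ℕ} (hN : 0 < N) {δ v : ℝ} (hδ : 0 < δ)
    (hv : E (fun a => f a ^ 2) ≤ v * (N * δ ^ 2)) :
    (average f E N).prob (fun x => δ < |x - E f|) ≤ v := by
  refine chebyshev _ _ _ hδ ((E.average_sub_sq_le f hN).trans ?_)
  rw [div_le_iff₀ (Nat.cast_pos.2 hN)]
  linarith

theorem sample_map (g : α → β) (N : ℕ) (f : (Fin N → β) → ℝ) :
    sample (g <$> E) N f = sample E N fun v => f (g ∘ v) := by
  induction N with
  | zero => exact congrArg f (Subsingleton.elim _ _)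
  | succ N ih =>
    simp only [sample_succ_apply, map_apply, ih, Fin.comp_cons]

variable {E}

theorem Commutes.sample {E' : Expectation β} (h : E.Commutes E') (N : ℕ) :
    (sample E N).Commutes E' := by
  induction N with
  | zero => exact fun f => rfl
  | succ N ih =>
    intro f
    simp only [sample_succ_apply]
    exact (congrArg E (funext fun a => ih fun v => f (Fin.cons a v))).trans (h _)

variable (E)

theorem pairAverage_apply (g : α → α → ℝ) (N : ℕ) (φ : ℝ → ℝ) :
    pairAverage g E N φ =
      sample E N fun u => sample E N fun v => φ ((∑ j, ∑ i, g (u i) (v j)) / N ^ 2) := rfl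

theorem pairAverage_map (h : α → β) (g : β → β → ℝ) (N : ℕ) (φ : ℝ → ℝ) :
    pairAverage g (h <$> E) N φ = pairAverage (fun a b => g (h a) (h b)) E N φ := by
  simp only [pairAverage_apply, sample_map, Function.comp_apply]

theorem pairAverage_mean (g : α → α → ℝ) {N : ℕ} (hN : 0 < N) :
    pairAverage g E N (fun x => x) = E fun a => E (g a) := by
  have hinner (u : Fin N → α) :
      AvgDeg.sample E N (fun v => ∑ j, ∑ i, g (u i) (v j)) = N * ∑ i, E (g (u i)) :=
    (E.sample_sum N fun b => ∑ i, g (u i) b).trans (by rw [map_sum])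
  have hN' : (N : ℝ) ≠ 0 := Nat.cast_ne_zero.2 hN.ne'
  simp only [pairAverage_apply, map_div_const, hinner, map_const_mul,
    sample_sum E N fun a => E (g a)]
  field_simp

variable {E}

theorem sample_sample_sum_sq_le (hE : E.Commutes E) (N : ℕ) {g : α → α → ℝ} {A V : ℝ}
    (hg : ∀ a b, 0 ≤ g a b) (hleft : ∀ a, E (g a) ≤ A) (hright : ∀ b, E (fun a => g a b) ≤ A)
    (hV : E (fun a => E fun b => g a b ^ 2) ≤ V) :
    AvgDeg.sample E N (fun u => AvgDeg.sample E N fun v => (∑ j, ∑ i, g (u i) (v j)) ^ 2) ≤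
      N ^ 2 * V + 2 * N ^ 3 * A ^ 2 + N ^ 4 * (E fun a => E (g a)) ^ 2 := by
  have sq_le {x : ℝ} (h0 : 0 ≤ x) (h : x ≤ A) : x ^ 2 ≤ A ^ 2 := by gcongr
  have hcol : AvgDeg.sample E N (fun u => E fun b => (∑ i, g (u i) b) ^ 2) ≤
      N * V + N ^ 2 * A ^ 2 := by
    rw [hE.sample N]
    calc E (fun b => AvgDeg.sample E N fun u => (∑ i, g (u i) b) ^ 2)
        ≤ E fun b => N * E (fun a => g a b ^ 2) + N ^ 2 * A ^ 2 := E.mono fun b => by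
          refine (E.sample_sum_sq_le N fun a => g a b).trans ?_
          rw [mul_pow]
          have := sq_le (E.nonneg fun a => hg a b) (hright b)
          gcongr
      _ ≤ N * V + N ^ 2 * A ^ 2 := by
          rw [map_add, map_const, map_const_mul, ← hE]
          gcongr
  have hrow : AvgDeg.sample E N (fun u => (∑ i, E (g (u i))) ^ 2) ≤
      N * A ^ 2 + N ^ 2 * (E fun a => E (g a)) ^ 2 := by
    refine (E.sample_sum_sq_le N fun a => E (g a)).trans ?_
    rw [mul_pow]
    gcongr
    exact E.le_const fun a => sq_le (E.nonneg (hg a)) (hleft a)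
  calc _ ≤ AvgDeg.sample E N fun u =>
        N * E (fun b => (∑ i, g (u i) b) ^ 2) + N ^ 2 * (∑ i, E (g (u i))) ^ 2 := by
        refine mono _ fun u => (E.sample_sum_sq_le N fun b => ∑ i, g (u i) b).trans ?_
        rw [mul_pow, map_sum]
    _ ≤ N * (N * V + N ^ 2 * A ^ 2) + N ^ 2 * (N * A ^ 2 + N ^ 2 * (E fun a => E (g a)) ^ 2) := by
        simp only [map_add, map_const_mul]
        gcongr
    _ = _ := by ring

theorem pairAverage_sq_le (hE : E.Commutes E) {N : ℕ} (hN : 0 < N) {g : α → α → ℝ} {A V : ℝ}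
    (hg : ∀ a b, 0 ≤ g a b) (hleft : ∀ a, E (g a) ≤ A) (hright : ∀ b, E (fun a => g a b) ≤ A)
    (hV : E (fun a => E fun b => g a b ^ 2) ≤ V) :
    pairAverage g E N (fun x => x ^ 2) ≤
      V / N ^ 2 + 2 * A ^ 2 / N + (E fun a => E (g a)) ^ 2 := by
  calc pairAverage g E N (fun x => x ^ 2)
      ≤ (N ^ 2 * V + 2 * N ^ 3 * A ^ 2 + N ^ 4 * (E fun a => E (g a)) ^ 2) / N ^ 4 := by
        simp only [pairAverage_apply, div_pow, map_div_const, ← pow_mul]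
        gcongr
        exact sample_sample_sum_sq_le hE N hg hleft hright hV
    _ = V / N ^ 2 + 2 * A ^ 2 / N + (E fun a => E (g a)) ^ 2 := by field_simp

end Expectation

/-- Randomized query procedures with a result in `α`, in continuation-passing style: the rest of
the algorithm is a function of the result. -/
def Program (M : Set Query) (α : Type) : Type := (α → Alg M) → Alg M

instance {M : Set Query} : Monad (Program M) where
  pure a k := k a
  bind P F k := P fun a => F a k

/-- On input `G` the program `P` has a result distributed according to `E` and costs at most `c`:
whatever is done with the result, the success probability is at least the expected one. -/
def Realizes {M : Set Query} {α : Type} (G : Graph) (P : Program M α) (E : Expectation α)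
    (c : ℕ) : Prop :=
  ∀ (T : Set ℝ) (k : α → Alg M) (q : ℕ),
    E (fun a => (hitProb G T (k a) q).toReal) ≤ (hitProb G T (P k) (q + c)).toReal

namespace Realizes

variable {M : Set Query} {α β : Type} {G : Graph} {P : Program M α} {E : Expectation α} {c c' : ℕ}

theorem mono (h : Realizes G P E c) (hc : c ≤ c') : Realizes G P E c' := fun T k q =>
  (h T k q).trans (ENNReal.toReal_mono (hitProb_ne_top G T _ _)
    (hitProb_mono G T _ (Nat.add_le_add_left hc q)))

theorem congr {E' : Expectation α} (h : Realizes G P E c) (hE : ∀ f, E f = E' f) :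
    Realizes G P E' c := fun T k q => hE _ ▸ h T k q

theorem pure (a : α) : Realizes (M := M) G (pure a) (pure a) 0 := fun _ _ _ => le_rfl

theorem bind {F : α → Program M β} {E' : α → Expectation β} (h : Realizes G P E c)
    (h' : ∀ a, Realizes G (F a) (E' a) c') : Realizes G (P >>= F) (E >>= E') (c + c') :=
  fun T k q => by
    rw [add_comm c, ← add_assoc]
    exact (E.mono fun a => h' a T k q).trans (h T (fun a => F a k) (q + c'))

theorem map (g : α → β) (h : Realizes G P E c) : Realizes G (g <$> P) (g <$> E) c :=
  fun T k q => h T (fun a => k (g a)) q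

theorem sample (h : Realizes G P E c) (N : ℕ) :
    Realizes G (sample P N) (sample E N) (N * c) := by
  induction N with
  | zero => exact (pure _).mono (Nat.zero_le _)
  | succ N ih => exact (h.bind fun a => ih.bind fun v => pure _).mono (by lia)

theorem average (h : Realizes G P E c) (f : α → ℝ) (N : ℕ) :
    Realizes G (average f P N) (average f E N) (N * c) :=
  (h.sample N).map _

theorem bind_pure {a : α} {F : α → Program M β} {E' : Expectation β}
    (h : Realizes G P (Pure.pure a) c) (h' : Realizes G (F a) E' c') :
    Realizes G (P >>= F) E' (c + c') := fun T k q => by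
  rw [add_comm c, ← add_assoc]
  exact (h' T k q).trans (h T (fun a => F a k) (q + c'))

end Realizes

theorem toReal_mean_uniformOfFinset {α : Type} (s : Finset α) (hs : s.Nonempty) {f : α → ℝ≥0∞}
    (hf : ∀ a, f a ≠ ⊤) : (mean (PMF.uniformOfFinset s hs) f).toReal =
      Expectation.unif s hs fun a => (f a).toReal := by
  rw [mean_uniformOfFinset, Expectation.unif_apply, ENNReal.toReal_mul, ENNReal.toReal_inv,
    ENNReal.toReal_natCast, ENNReal.toReal_sum fun a _ => hf a]

namespace Program

variable {M : Set Query} {G : Graph}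

/-- A fair coin flip. -/
def coin : Program M ℕ :=
  .toss (PMF.uniformOfFinset (Finset.range 2) (Finset.nonempty_range_iff.2 two_ne_zero))

theorem realizes_coin : Realizes (M := M) G coin
    (.unif (Finset.range 2) (Finset.nonempty_range_iff.2 two_ne_zero)) 0 := fun T k q => by
  rw [coin, hitProb_toss, toReal_mean_uniformOfFinset _ _ fun i => hitProb_ne_top G T (k i) _,
    add_zero]

/-- A single query. -/
def ask (x : Query) (hx : x ∈ M) : Program M x.Answer := .query x hx

theorem realizes_ask_unif {x : Query} (hx : x ∈ M) {s : Finset x.Answer} {hs : s.Nonempty}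
    (h : G.answer x = PMF.uniformOfFinset s hs) :
    Realizes G (ask x hx) (.unif s hs) x.cost := fun T k q => by
  rw [ask, hitProb_query_add, h,
    toReal_mean_uniformOfFinset _ _ fun a => hitProb_ne_top G T (k a) _]

theorem realizes_ask_pure {x : Query} (hx : x ∈ M) {a : x.Answer} (h : G.answer x = PMF.pure a) :
    Realizes G (ask x hx) (pure a) x.cost := fun T k q => by
  rw [ask, hitProb_query_add, h, mean_pure]
  rfl

end Program

theorem Graph.sum_sum_adj_eq (G : Graph) (S S' : Finset ℕ) : ∑ x ∈ S, ∑ y ∈ S', G.adj x y =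
    (G.edgesIn (S ∪ S')).card + (G.edgesIn (S ∩ S')).card - (G.edgesIn (S \ S')).card -
      (G.edgesIn (S' \ S)).card := by
  have hleft (f : ℕ → ℝ) : ∑ x ∈ S, f x = ∑ x ∈ S \ S', f x + ∑ x ∈ S ∩ S', f x := by
    rw [add_comm, Finset.sum_inter_add_sum_sdiff]
  have hright (f : ℕ → ℝ) : ∑ x ∈ S', f x = ∑ x ∈ S' \ S, f x + ∑ x ∈ S ∩ S', f x := by
    rw [Finset.inter_comm, add_comm, Finset.sum_inter_add_sum_sdiff]
  have hunion (f : ℕ → ℝ) : ∑ x ∈ S ∪ S', f x =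
      ∑ x ∈ S \ S', f x + ∑ x ∈ S' \ S, f x + ∑ x ∈ S ∩ S', f x := by
    rw [← Finset.sdiff_union_self_eq_union, Finset.sum_union Finset.sdiff_disjoint, hright,
      add_assoc]
  have hcomm (A B : Finset ℕ) : ∑ x ∈ A, ∑ y ∈ B, G.adj x y = ∑ x ∈ B, ∑ y ∈ A, G.adj x y := by
    rw [Finset.sum_comm]
    simp only [G.adj_comm]
  have hedges := G.two_mul_card_edgesIn (S ∪ S')
  simp only [hunion, Finset.sum_add_distrib] at hedges
  rw [hleft]
  simp only [hright, Finset.sum_add_distrib]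
  linarith [G.two_mul_card_edgesIn (S ∩ S'), G.two_mul_card_edgesIn (S \ S'),
    G.two_mul_card_edgesIn (S' \ S), hcomm (S \ S') (S' \ S), hcomm (S \ S') (S ∩ S'),
    hcomm (S' \ S) (S ∩ S')]

theorem cast_eq_sum_bitIndices {k B : ℕ} (hk : k < 2 ^ B) :
    (k : ℝ) = ∑ i ∈ Finset.range B, if i ∈ k.bitIndices then 2 ^ i else 0 := by
  have hsub : k.bitIndices.toFinset ⊆ Finset.range B := fun i hi =>
    Finset.mem_range.2 ((Nat.pow_lt_pow_iff_right one_lt_two).1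
      ((Nat.two_pow_le_of_mem_bitIndices (List.mem_toFinset.1 hi)).trans_lt hk))
  conv_lhs => rw [← Finset.sum_toFinset_bitIndices_two_pow k]
  push_cast
  simp only [← List.mem_toFinset]
  rw [Finset.sum_ite_mem, Finset.inter_eq_right.2 hsub]

namespace Program

variable {M : Set Query} {G : Graph}

/-- The sum of the results of the procedures `P 0, …, P (B - 1)`. -/
def sumRange (P : ℕ → Program M ℝ) : ℕ → Program M ℝ
  | 0 => pure 0
  | B + 1 => do
    let s ← sumRange P B
    let x ← P B
    pure (s + x)

/-- A weighted sum over `A` from unweighted sums over subsets of `A`, one for every binary digit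
of the weights. -/
def weightedSum (β : ℕ → ℕ) (A : Finset ℕ) (P : Finset ℕ → Program M ℝ) (B : ℕ) : Program M ℝ :=
  sumRange (fun i => (2 ^ i * ·) <$> P (A.filter fun x => i ∈ (β x).bitIndices)) B

theorem realizes_sumRange {P : ℕ → Program M ℝ} {f : ℕ → ℝ} {c : ℕ}
    (h : ∀ i, Realizes G (P i) (pure (f i)) c) (B : ℕ) :
    Realizes G (sumRange P B) (pure (∑ i ∈ Finset.range B, f i)) (B * c) := by
  induction B with
  | zero => exact (Realizes.pure _).mono (Nat.zero_le _)
  | succ B ih =>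
    rw [Finset.sum_range_succ, sumRange]
    exact Realizes.mono (ih.bind_pure ((h B).bind_pure (.pure _))) (by lia)

theorem realizes_weightedSum {P : Finset ℕ → Program M ℝ} {f : ℕ → ℝ} {β : ℕ → ℕ} {A : Finset ℕ}
    {B c : ℕ} (hβ : ∀ x, β x < 2 ^ B)
    (h : ∀ S ⊆ A, Realizes G (P S) (pure (∑ x ∈ S, f x)) c) :
    Realizes G (weightedSum β A P B) (pure (∑ x ∈ A, β x * f x)) (B * c) := by
  have hsum : ∑ x ∈ A, β x * f x =
      ∑ i ∈ Finset.range B, 2 ^ i * ∑ x ∈ A with i ∈ (β x).bitIndices, f x := by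
    simp only [cast_eq_sum_bitIndices (hβ _), Finset.sum_mul, Finset.mul_sum, Finset.sum_filter]
    rw [Finset.sum_comm]
    simp only [ite_mul, zero_mul, mul_ite, mul_zero]
  rw [hsum]
  exact realizes_sumRange (fun i => (h _ (Finset.filter_subset _ _)).map _) B

theorem additive_mem (S : Finset ℕ) : .additive S ∈ advancedModel := trivial

/-- The number of ordered adjacent pairs in `S ×ˢ S'`. -/
def cut (S S' : Finset ℕ) : Program advancedModel ℝ := do
  let union ← ask _ (additive_mem (S ∪ S'))
  let inter ← ask _ (additive_mem (S ∩ S'))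
  let left ← ask _ (additive_mem (S \ S'))
  let right ← ask _ (additive_mem (S' \ S))
  pure ((union : ℕ) + (inter : ℕ) - (left : ℕ) - (right : ℕ) : ℝ)

theorem realizes_cut (S S' : Finset ℕ) :
    Realizes G (cut S S') (pure (∑ x ∈ S, ∑ y ∈ S', G.adj x y)) (2 * (S.card + S'.card)) := by
  have hadd (A : Finset ℕ) : Realizes G (ask _ (additive_mem A)) (pure (G.edgesIn A).card) A.card :=
    realizes_ask_pure (additive_mem A) rfl
  rw [G.sum_sum_adj_eq, cut]
  refine Realizes.mono ((hadd _).bind_pure ((hadd _).bind_pure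
    ((hadd _).bind_pure ((hadd _).bind_pure (.pure _))))) ?_
  have h₁ := Finset.card_union_add_card_inter S S'
  have h₂ := Finset.card_sdiff_add_card_inter S S'
  have h₃ := Finset.card_sdiff_add_card_inter S' S
  rw [Finset.inter_comm S' S] at h₃
  lia

/-- The value of the bilinear form of the adjacency matrix at two weight functions. -/
def weightedCut (α β : ℕ → ℕ) (S S' : Finset ℕ) (B : ℕ) : Program advancedModel ℝ :=
  weightedSum α S (fun A => weightedSum β S' (fun A' => cut A A') B) B

theorem realizes_weightedCut {α β : ℕ → ℕ} {B : ℕ} (hα : ∀ x, α x < 2 ^ B) (hβ : ∀ x, β x < 2 ^ B)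
    (S S' : Finset ℕ) : Realizes G (weightedCut α β S S' B)
      (pure (∑ x ∈ S, α x * ∑ y ∈ S', β y * G.adj x y)) (B * (B * (2 * (S.card + S'.card)))) := by
  refine realizes_weightedSum hα fun A hA => ?_
  rw [Finset.sum_comm]
  simp only [← Finset.mul_sum]
  refine realizes_weightedSum hβ fun A' hA' => ?_
  rw [Finset.sum_comm]
  exact (realizes_cut A A').mono
    (by have := Finset.card_le_card hA; have := Finset.card_le_card hA'; lia)

end Program

/-- What is observed of a random edge with a random orientation: its tail and the degrees of its
tail and of its head. -/
structure HalfEdge where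
  vertex : ℕ
  degree : ℕ
  nbrDegree : ℕ

namespace Graph

variable (G : Graph)

/-- The ordered pairs of adjacent vertices. -/
def darts : Finset (ℕ × ℕ) := G.dartsIn G.verts

theorem card_darts : (G.darts.card : ℝ) = G.n * G.avgDeg := by
  have h := G.sum_dartsIn G.verts fun _ => 1
  simp only [mul_one, sum_adj, Finset.sum_const, nsmul_eq_mul] at h
  rw [darts, h, n_mul_avgDeg]

theorem darts_nonempty : G.darts.Nonempty := by
  have h : (0 : ℝ) < G.darts.card := by
    rw [card_darts]
    exact mul_pos (Nat.cast_pos.2 G.n_pos) (zero_lt_one.trans_le G.one_le_avgDeg)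
  exact Finset.card_pos.1 (Nat.cast_pos.1 h)

/-- The uniform distribution on the darts. -/
def uniformDart : Expectation (ℕ × ℕ) := .unif G.darts G.darts_nonempty

/-- The half-edge observed at a dart. -/
def halfEdge (p : ℕ × ℕ) : HalfEdge := ⟨p.1, G.deg p.1, G.deg p.2⟩

/-- The distribution of the degree of a uniform vertex. -/
def uniformDegree : Expectation ℕ := G.deg <$> .unif G.verts G.nonempty

theorem uniformDart_apply (f : ℕ × ℕ → ℝ) : G.uniformDart f =
    (G.n * G.avgDeg)⁻¹ * ∑ x ∈ G.verts, ∑ y ∈ G.verts, G.adj x y * f (x, y) := by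
  rw [uniformDart, Expectation.unif_apply, card_darts, darts, sum_dartsIn]

theorem uniformDart_fst (f : ℕ → ℝ) : G.uniformDart (fun p => f p.1) =
    (G.n * G.avgDeg)⁻¹ * ∑ x ∈ G.verts, G.deg x * f x := by
  simp only [uniformDart_apply, ← Finset.sum_mul, sum_adj]

theorem uniformDart_swap (f : ℕ × ℕ → ℝ) :
    G.uniformDart (fun p => f p.swap) = G.uniformDart f := by
  rw [uniformDart_apply, uniformDart_apply, Finset.sum_comm]
  simp only [Prod.swap_prod_mk, G.adj_comm]

theorem uniformDart_commutes {α : Type} (E : Expectation α) : G.uniformDart.Commutes E :=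
  Expectation.commutes_unif _ _ _

theorem uniformDegree_apply (f : ℕ → ℝ) :
    G.uniformDegree f = (G.n : ℝ)⁻¹ * ∑ x ∈ G.verts, f (G.deg x) := by
  rw [uniformDegree, Expectation.map_apply, Expectation.unif_apply, n]

end Graph

namespace Program

theorem degree_mem (x : ℕ) : .degree x ∈ advancedModel := trivial

/-- The half-edge at the dart `p`. -/
def observe (p : ℕ × ℕ) : Program advancedModel HalfEdge := do
  let d ← ask _ (degree_mem p.1)
  let d' ← ask _ (degree_mem p.2)
  pure ⟨p.1, d, d'⟩

/-- The orientation of the edge `e` numbered by `i`. -/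
def orient (e : Sym2 ℕ) (i : ℕ) : ℕ × ℕ := if i = 0 then (e.inf, e.sup) else (e.sup, e.inf)

/-- A uniformly random half-edge. -/
def halfEdge : Program advancedModel HalfEdge := do
  let e ← ask .randEdge trivial
  let i ← coin
  observe (orient e i)

/-- The degree of a uniformly random vertex. -/
def vertexDegree : Program advancedModel ℕ := do
  let x ← ask .randVert trivial
  ask _ (degree_mem x)

variable (G : Graph)

theorem realizes_ask_degree (x : ℕ) :
    Realizes G (ask _ (degree_mem x)) (pure (G.deg x)) 1 := realizes_ask_pure (degree_mem x) rfl

theorem realizes_vertexDegree : Realizes G vertexDegree G.uniformDegree 2 :=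
  Realizes.bind (realizes_ask_unif (x := .randVert) (M := advancedModel) trivial rfl)
    (realizes_ask_degree G)

theorem realizes_observe (p : ℕ × ℕ) : Realizes G (observe p) (pure (G.halfEdge p)) 2 := by
  rw [observe]
  exact Realizes.mono (Realizes.bind_pure (realizes_ask_degree G p.1)
    (Realizes.bind_pure (realizes_ask_degree G p.2) (Realizes.pure (G.halfEdge p)))) le_rfl

theorem realizes_halfEdge : Realizes G halfEdge (G.halfEdge <$> G.uniformDart) 3 := by
  have hrun : Realizes G halfEdge (Expectation.unif G.edges G.edges_nonempty >>= fun e =>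
      Expectation.unif (Finset.range 2) (Finset.nonempty_range_iff.2 two_ne_zero) >>= fun i =>
        pure (G.halfEdge (orient e i))) (1 + (0 + 2)) :=
    Realizes.bind (realizes_ask_unif (x := .randEdge) (M := advancedModel) trivial rfl) fun e =>
      Realizes.bind realizes_coin fun i => realizes_observe G (orient e i)
  have hedges (F : ℕ × ℕ → ℝ) : ∑ p ∈ G.darts, F p =
      ∑ e ∈ G.edges, (F (e.inf, e.sup) + F (e.sup, e.inf)) :=
    G.sum_dartsIn_eq_sum_edgesIn G.verts F
  refine hrun.congr fun f => ?_
  simp only [Expectation.bind_apply, Expectation.pure_apply, Expectation.map_apply,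
    Expectation.unif_apply, Graph.uniformDart, G.card_darts, ← G.two_mul_card_edges, hedges,
    Finset.sum_range_succ, Finset.sum_range_zero, Finset.card_range, ← Finset.mul_sum, orient,
    if_pos, one_ne_zero, if_false]
  norm_num
  ring

end Program

section Weight

variable (n t δ : ℕ)

/-- The weight of a vertex of degree `δ` at scale `t`: it is `n / δ` for the heavy vertices, those
of degree more than `n / t ^ 3`, so that sampling by degree and then weighting is nearly uniform
on them; the other vertices have weight zero. -/
def weight : ℕ := if n < δ * t ^ 3 then n / δ else 0

/-- The indicator of the vertices that are not heavy. -/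
def light : ℝ := if n < δ * t ^ 3 then 0 else 1

/-- The indicator of the heavy vertices up to the rounding of the weights. -/
def heavy : ℝ := δ * weight n t δ / n

theorem weight_le : weight n t δ ≤ n := by
  unfold weight
  split_ifs
  exacts [Nat.div_le_self _ _, n.zero_le]

theorem weight_le_pow : weight n t δ ≤ t ^ 3 := by
  unfold weight
  split_ifs with h
  exacts [Nat.div_le_of_le_mul h.le, Nat.zero_le _]

theorem mul_weight_le : δ * weight n t δ ≤ n := by
  unfold weight
  split_ifs
  exacts [Nat.mul_div_le n δ, n.zero_le]

theorem light_nonneg : 0 ≤ light n t δ := by unfold light; split_ifs <;> norm_num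

theorem light_le_one : light n t δ ≤ 1 := by unfold light; split_ifs <;> norm_num

theorem heavy_nonneg : 0 ≤ heavy n t δ := by unfold heavy; positivity

theorem heavy_le_one : heavy n t δ ≤ 1 :=
  div_le_one_of_le₀ (by exact_mod_cast mul_weight_le n t δ) n.cast_nonneg

variable {n t δ}

theorem light_eq_one (h : ¬ n < δ * t ^ 3) : light n t δ = 1 := if_neg h

theorem one_le_two_mul_heavy (hδ : δ ≤ n) (h : n < δ * t ^ 3) : 1 ≤ 2 * heavy n t δ := by
  have hpos : 0 < δ := Nat.pos_of_mul_pos_right (n.zero_le.trans_lt h)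
  have hle : n ≤ 2 * (δ * (n / δ)) := by
    have h1 : 1 ≤ n / δ := (Nat.one_le_div_iff hpos).2 hδ
    nlinarith [Nat.lt_mul_div_succ n hpos]
  rw [heavy, weight, if_pos h, ← mul_div_assoc, one_le_div (by exact_mod_cast hpos.trans_le hδ)]
  exact_mod_cast hle

theorem sq_mul_light_le (ht : 0 < t) :
    (δ * light n t δ) ^ 2 ≤ n / t ^ 3 * (δ * light n t δ) := by
  unfold light
  split_ifs with h
  · simp only [mul_zero, ne_eq, OfNat.ofNat_ne_zero, not_false_eq_true, zero_pow, le_refl]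
  · have hle : (δ : ℝ) ≤ n / t ^ 3 := by
      rw [le_div_iff₀ (by positivity)]
      exact_mod_cast not_lt.1 h
    rw [mul_one, sq]
    gcongr

end Weight

/-- The indicator of the half-edges with both ends heavy, up to the rounding of the weights. -/
def HalfEdge.heaviness (n t : ℕ) (e : HalfEdge) : ℝ :=
  heavy n t e.degree * heavy n t e.nbrDegree

namespace HalfEdge

theorem heaviness_nonneg (n t : ℕ) (e : HalfEdge) : 0 ≤ e.heaviness n t :=
  mul_nonneg (heavy_nonneg _ _ _) (heavy_nonneg _ _ _)

theorem heaviness_le_one (n t : ℕ) (e : HalfEdge) : e.heaviness n t ≤ 1 :=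
  mul_le_one₀ (heavy_le_one _ _ _) (heavy_nonneg _ _ _) (heavy_le_one _ _ _)

end HalfEdge

namespace Graph

variable (G : Graph) (t : ℕ)

theorem avgDeg_pos : 0 < G.avgDeg := zero_lt_one.trans_le G.one_le_avgDeg

/-- The fraction of the half-edges whose tail is light. -/
def lightFrac : ℝ := G.uniformDart fun p => light G.n t (G.deg p.1)

/-- The fraction of the half-edges with both ends heavy, up to the rounding of the weights. -/
def heavyFrac : ℝ := G.uniformDart fun p => (G.halfEdge p).heaviness G.n t

theorem lightFrac_nonneg : 0 ≤ G.lightFrac t := Expectation.nonneg _ fun _ => light_nonneg _ _ _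

theorem heavyFrac_nonneg : 0 ≤ G.heavyFrac t :=
  Expectation.nonneg _ fun _ => HalfEdge.heaviness_nonneg _ _ _

theorem heavyFrac_le_one : G.heavyFrac t ≤ 1 :=
  Expectation.le_const _ fun _ => HalfEdge.heaviness_le_one _ _ _

theorem one_le_heavyFrac_add_lightFrac : 1 ≤ 4 * G.heavyFrac t + 2 * G.lightFrac t := by
  have hpoint (x y : ℕ) : 1 ≤ 4 * (heavy G.n t (G.deg x) * heavy G.n t (G.deg y)) +
      light G.n t (G.deg x) + light G.n t (G.deg y) := by
    have hmul := mul_nonneg (heavy_nonneg G.n t (G.deg x)) (heavy_nonneg G.n t (G.deg y))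
    by_cases hx : G.n < G.deg x * t ^ 3
    · by_cases hy : G.n < G.deg y * t ^ 3
      · have := one_le_mul_of_one_le_of_one_le (one_le_two_mul_heavy (G.deg_le x) hx)
          (one_le_two_mul_heavy (G.deg_le y) hy)
        linarith [light_nonneg G.n t (G.deg x), light_nonneg G.n t (G.deg y)]
      · linarith [light_eq_one hy, light_nonneg G.n t (G.deg x)]
    · linarith [light_eq_one hx, light_nonneg G.n t (G.deg y)]
  have hmean := G.uniformDart.mono fun p => hpoint p.1 p.2
  have hswap := G.uniformDart_swap fun p => light G.n t (G.deg p.1)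
  simp only [Expectation.map_add, Expectation.map_const_mul, Expectation.map_const,
    Prod.fst_swap] at hmean hswap
  rw [hswap] at hmean
  calc 1 ≤ 4 * G.heavyFrac t + G.lightFrac t + G.lightFrac t := hmean
    _ = _ := by ring

theorem uniformDart_inv_deg : G.uniformDart (fun p => (G.deg p.1 : ℝ)⁻¹) = G.avgDeg⁻¹ := by
  have hn : (G.n : ℝ) ≠ 0 := Nat.cast_ne_zero.2 G.n_pos.ne'
  have hsum : ∑ x ∈ G.verts, (G.deg x : ℝ) * (G.deg x : ℝ)⁻¹ = G.n := by
    rw [Finset.sum_congr rfl fun x hx =>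
      mul_inv_cancel₀ (Nat.cast_ne_zero.2 (G.deg_pos hx).ne'), Finset.sum_const, nsmul_one, n]
  rw [G.uniformDart_fst fun x => (G.deg x : ℝ)⁻¹, hsum, mul_inv, mul_right_comm,
    inv_mul_cancel₀ hn, one_mul]

theorem uniformDart_sq_inv_deg_le :
    G.uniformDart (fun p => (G.deg p.1 : ℝ)⁻¹ ^ 2) ≤ G.avgDeg⁻¹ := by
  rw [← uniformDart_inv_deg]
  exact Expectation.mono _ fun p => pow_le_of_le_one (by positivity) (Nat.cast_inv_le_one _)
    two_ne_zero

theorem uniformDegree_light :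
    G.uniformDegree (fun δ => δ * light G.n t δ) = G.avgDeg * G.lightFrac t := by
  have hd := G.avgDeg_pos.ne'
  rw [uniformDegree_apply, lightFrac, G.uniformDart_fst fun x => light G.n t (G.deg x)]
  field_simp

theorem uniformDegree_sq_light_le (ht : 0 < t) :
    G.uniformDegree (fun δ => (δ * light G.n t δ) ^ 2) ≤
      G.n / t ^ 3 * (G.avgDeg * G.lightFrac t) := by
  rw [← uniformDegree_light, ← Expectation.map_const_mul]
  exact Expectation.mono _ fun δ => sq_mul_light_le ht

/-- The weight of a pair of half-edges whose tails form an edge. Its mean over pairs of random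
half-edges counts the edges between heavy vertices. -/
def pairKernel (e e' : HalfEdge) : ℝ :=
  weight G.n t e.degree * weight G.n t e'.degree * G.adj e.vertex e'.vertex / G.n

theorem pairKernel_nonneg (e e' : HalfEdge) : 0 ≤ G.pairKernel t e e' :=
  div_nonneg (mul_nonneg (by positivity) (G.adj_nonneg _ _)) G.n.cast_nonneg

theorem pairKernel_comm (e e' : HalfEdge) : G.pairKernel t e e' = G.pairKernel t e' e := by
  rw [pairKernel, pairKernel, G.adj_comm, mul_comm (weight _ _ _ : ℝ)]

theorem pairKernel_le (e e' : HalfEdge) : G.pairKernel t e e' ≤ t ^ 6 / G.n := by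
  have hw (δ : ℕ) : (weight G.n t δ : ℝ) ≤ t ^ 3 := by exact_mod_cast weight_le_pow G.n t δ
  rw [pairKernel]
  gcongr
  calc (weight G.n t e.degree * weight G.n t e'.degree * G.adj e.vertex e'.vertex : ℝ)
      ≤ t ^ 3 * t ^ 3 * 1 := by
        gcongr
        exacts [G.adj_nonneg _ _, hw _, hw _, G.adj_le_one _ _]
    _ = t ^ 6 := by ring

theorem uniformDart_pairKernel (p : ℕ × ℕ) :
    G.uniformDart (fun p' => G.pairKernel t (G.halfEdge p) (G.halfEdge p')) =
      (G.n * G.avgDeg)⁻¹ * (weight G.n t (G.deg p.1) *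
        ∑ y ∈ G.verts, G.adj p.1 y * heavy G.n t (G.deg y)) := by
  refine (G.uniformDart_fst fun y => G.pairKernel t (G.halfEdge p) ⟨y, G.deg y, 0⟩).trans ?_
  rw [Finset.mul_sum _ _ (weight _ _ _ : ℝ)]
  refine congrArg _ (Finset.sum_congr rfl fun y _ => ?_)
  simp only [pairKernel, halfEdge, heavy]
  ring

theorem uniformDart_pairKernel_le (p : ℕ × ℕ) :
    G.uniformDart (fun p' => G.pairKernel t (G.halfEdge p) (G.halfEdge p')) ≤ G.avgDeg⁻¹ := by
  have hn : (0 : ℝ) < G.n := Nat.cast_pos.2 G.n_pos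
  have hd := G.avgDeg_pos
  have hheavy : ∑ y ∈ G.verts, G.adj p.1 y * heavy G.n t (G.deg y) ≤ G.deg p.1 := by
    rw [← sum_adj]
    exact Finset.sum_le_sum fun y _ =>
      mul_le_of_le_one_right (G.adj_nonneg _ _) (heavy_le_one _ _ _)
  calc G.uniformDart (fun p' => G.pairKernel t (G.halfEdge p) (G.halfEdge p'))
      ≤ (G.n * G.avgDeg)⁻¹ * (weight G.n t (G.deg p.1) * G.deg p.1) := by
        rw [uniformDart_pairKernel]
        gcongr
    _ ≤ (G.n * G.avgDeg)⁻¹ * G.n := by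
        gcongr
        rw [mul_comm]
        exact_mod_cast mul_weight_le G.n t (G.deg p.1)
    _ = G.avgDeg⁻¹ := by field_simp

theorem uniformDart_uniformDart_pairKernel :
    G.uniformDart (fun p => G.uniformDart fun p' =>
      G.pairKernel t (G.halfEdge p) (G.halfEdge p')) = G.heavyFrac t / G.avgDeg := by
  have hn : (G.n : ℝ) ≠ 0 := Nat.cast_ne_zero.2 G.n_pos.ne'
  have hd := G.avgDeg_pos.ne'
  have hrow (x : ℕ) : (G.deg x : ℝ) * (weight G.n t (G.deg x) *
      ∑ y ∈ G.verts, G.adj x y * heavy G.n t (G.deg y)) = G.n *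
        ∑ y ∈ G.verts, G.adj x y * (heavy G.n t (G.deg x) * heavy G.n t (G.deg y)) := by
    simp only [mul_left_comm (G.adj x _), ← Finset.mul_sum]
    rw [heavy]
    field_simp
  simp only [uniformDart_pairKernel, Expectation.map_const_mul]
  rw [G.uniformDart_fst fun x => weight G.n t (G.deg x) *
    ∑ y ∈ G.verts, G.adj x y * heavy G.n t (G.deg y), heavyFrac, uniformDart_apply]
  simp only [hrow, ← Finset.mul_sum, HalfEdge.heaviness, halfEdge]
  field_simp

theorem pairAverage_pairKernel_sq_le {N : ℕ} (hN : 0 < N) :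
    pairAverage (G.pairKernel t) (G.halfEdge <$> G.uniformDart) N (fun z => z ^ 2) ≤
      t ^ 6 / G.n * G.avgDeg⁻¹ / N ^ 2 + 2 * G.avgDeg⁻¹ ^ 2 / N +
        (G.heavyFrac t / G.avgDeg) ^ 2 := by
  rw [Expectation.pairAverage_map, ← uniformDart_uniformDart_pairKernel]
  refine Expectation.pairAverage_sq_le (G.uniformDart_commutes _) hN
    (fun _ _ => G.pairKernel_nonneg t _ _) (G.uniformDart_pairKernel_le t)
    (fun p' => ?_) ?_
  · simp only [G.pairKernel_comm t _ (G.halfEdge p')]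
    exact G.uniformDart_pairKernel_le t p'
  · have hsq (e e' : HalfEdge) : G.pairKernel t e e' ^ 2 ≤ t ^ 6 / G.n * G.pairKernel t e e' := by
      rw [sq]
      exact mul_le_mul_of_nonneg_right (G.pairKernel_le t e e') (G.pairKernel_nonneg t e e')
    refine Expectation.le_const _ fun p => (Expectation.mono _ fun p' => hsq _ _).trans ?_
    rw [Expectation.map_const_mul]
    gcongr
    exact G.uniformDart_pairKernel_le t p

theorem pairAverage_pairKernel {N : ℕ} (hN : 0 < N) :
    pairAverage (G.pairKernel t) (G.halfEdge <$> G.uniformDart) N (fun z => z) =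
      G.heavyFrac t / G.avgDeg := by
  rw [Expectation.pairAverage_map, Expectation.pairAverage_mean _ _ hN,
    uniformDart_uniformDart_pairKernel]

end Graph

namespace Program

section Pairs

variable {N : ℕ} (n t : ℕ) (u : Fin N → HalfEdge)

/-- The tails of the half-edges `u`. -/
def tails : Finset ℕ := Finset.univ.image fun i => (u i).vertex

/-- The total weight of the half-edges in `u` with tail `x`. -/
def tailWeight (x : ℕ) : ℕ := ∑ i with (u i).vertex = x, weight n t (u i).degree

theorem card_tails_le : (tails u).card ≤ N :=
  Finset.card_image_le.trans (Finset.card_univ.trans (Fintype.card_fin N)).le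

theorem tailWeight_le (x : ℕ) : tailWeight n t u x ≤ N * n :=
  calc tailWeight n t u x ≤ ∑ _i : Fin N, n :=
        (Finset.sum_le_univ_sum_of_nonneg fun _ => Nat.zero_le _).trans
          (Finset.sum_le_sum fun _ _ => weight_le n t _)
    _ = N * n := by rw [Finset.sum_const, Finset.card_univ, Fintype.card_fin, smul_eq_mul]

theorem sum_tailWeight_mul (F : ℕ → ℝ) : ∑ x ∈ tails u, tailWeight n t u x * F x =
    ∑ i, weight n t (u i).degree * F (u i).vertex := by
  rw [← Finset.sum_fiberwise_of_maps_to (s := Finset.univ) (t := tails u)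
    (fun i _ => Finset.mem_image_of_mem (fun i => (u i).vertex) (Finset.mem_univ i))]
  refine Finset.sum_congr rfl fun x _ => ?_
  rw [tailWeight, Nat.cast_sum, Finset.sum_mul]
  exact Finset.sum_congr rfl fun i hi => by rw [(Finset.mem_filter.1 hi).2]

end Pairs

/-- The average of the pair kernel over all pairs of two samples of `N` half-edges. The additive
queries are made to sets of tails, so that their cost is linear in `N` although the number of
pairs is quadratic. -/
def pairs (n t N B : ℕ) : Program advancedModel ℝ := do
  let u ← sample halfEdge N
  let v ← sample halfEdge N
  (· / n / N ^ 2) <$> weightedCut (tailWeight n t u) (tailWeight n t v) (tails u) (tails v) B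

variable (G : Graph)

theorem realizes_pairs {t N B : ℕ} (hB : N * G.n < 2 ^ B) :
    Realizes G (pairs G.n t N B)
      (pairAverage (G.pairKernel t) (G.halfEdge <$> G.uniformDart) N)
      (N * 3 + (N * 3 + B * (B * (2 * (N + N))))) := by
  have hlt (u : Fin N → HalfEdge) (x : ℕ) : tailWeight G.n t u x < 2 ^ B :=
    (tailWeight_le G.n t u x).trans_lt hB
  have hsum (u v : Fin N → HalfEdge) :
      (∑ x ∈ tails u, tailWeight G.n t u x *
        ∑ y ∈ tails v, tailWeight G.n t v y * G.adj x y) / (G.n : ℝ) / (N : ℝ) ^ 2 =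
        (∑ j, ∑ i, G.pairKernel t (u i) (v j)) / (N : ℝ) ^ 2 := by
    rw [sum_tailWeight_mul _ _ u fun x => ∑ y ∈ tails v, tailWeight G.n t v y * G.adj x y]
    simp only [sum_tailWeight_mul, Finset.mul_sum, ← mul_assoc, Graph.pairKernel, ← Finset.sum_div]
    rw [Finset.sum_comm]
  have hsample := (realizes_halfEdge G).sample N
  refine hsample.bind fun u => hsample.bind fun v => ?_
  rw [← hsum]
  refine Realizes.mono (Realizes.map (· / (G.n : ℝ) / (N : ℝ) ^ 2)
    (realizes_weightedCut (hlt u) (hlt v) _ _)) ?_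
  gcongr
  exacts [card_tails_le u, card_tails_le v]

end Program

/-- The five statistics measured at one scale. -/
structure Estimates where
  invDeg : ℝ
  heavyFrac : ℝ
  lightFrac : ℝ
  lightDeg : ℝ
  pairs : ℝ

/-- The five statistics at scale `t`, from averages over `M` and `R` samples. It is stated for
arbitrary monads in order to apply both to programs and to the expectations they realize. -/
def measure {m : Type → Type} [Monad m] (n t M R : ℕ) (halfEdge : m HalfEdge) (degree : m ℕ)
    (pairs : m ℝ) : m Estimates := do
  let invDeg ← average (fun e => (e.degree : ℝ)⁻¹) halfEdge M
  let heavyFrac ← average (HalfEdge.heaviness n t) halfEdge R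
  let lightFrac ← average (fun e => light n t e.degree) halfEdge R
  let lightDeg ← average (fun δ => δ * light n t δ) degree M
  let pairs ← average id pairs R
  pure ⟨invDeg, heavyFrac, lightFrac, lightDeg, pairs⟩

theorem Realizes.measure {M : Set Query} {G : Graph} {P : Program M HalfEdge}
    {P' : Program M ℕ} {P'' : Program M ℝ} {E : Expectation HalfEdge} {E' : Expectation ℕ}
    {E'' : Expectation ℝ} {c c' c'' : ℕ} (h : Realizes G P E c) (h' : Realizes G P' E' c')
    (h'' : Realizes G P'' E'' c'') (n t N R : ℕ) :
    Realizes G (measure n t N R P P' P'') (measure n t N R E E' E'')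
      (N * c + (R * c + (R * c + (N * c' + (R * c'' + 0))))) :=
  (h.average _ N).bind fun _ => (h.average _ R).bind fun _ => (h.average _ R).bind fun _ =>
    (h'.average _ N).bind fun _ => (h''.average _ R).bind fun _ => .pure _

/-- The distribution of the five statistics of `G` at scale `t`. -/
def Graph.estimates (G : Graph) (t M R N : ℕ) : Expectation Estimates :=
  measure G.n t M R (G.halfEdge <$> G.uniformDart) G.uniformDegree
    (pairAverage (G.pairKernel t) (G.halfEdge <$> G.uniformDart) N)

/-- The five statistics of the estimates `e` at scale `t` are close to their means, up to a relative
error of order `ε` or an absolute error of order `ε` times the level below which they are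
ignored. -/
structure Estimates.Accurate (e : Estimates) (G : Graph) (t : ℕ) (ε : ℝ) : Prop where
  invDeg : |e.invDeg - G.avgDeg⁻¹| ≤ ε / 8 * max G.avgDeg⁻¹ (1 / t)
  heavyFrac : |e.heavyFrac - G.heavyFrac t| ≤ ε / 256
  lightFrac : |e.lightFrac - G.lightFrac t| ≤ ε / 256
  lightDeg : |e.lightDeg - G.avgDeg * G.lightFrac t| ≤
    ε / 8 * max (G.avgDeg * G.lightFrac t) (G.n / t ^ 4)
  pairs : |e.pairs - G.heavyFrac t / G.avgDeg| ≤
    ε / 256 * max G.avgDeg⁻¹ (t ^ 4 / (1024 ^ 2 * G.n))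

theorem Expectation.prob_average_le_of_sq_le {α : Type} (E : Expectation α) {f : α → ℝ} {N : ℕ}
    {K r ε a c m : ℝ} (hK : 0 < K) (hr : 0 < r) (hε : 0 < ε) (hN : K * r ≤ N * ε ^ 2)
    (hc : 0 < c) (hm : 0 < m) (h : E (fun x => f x ^ 2) ≤ a * (r * m ^ 2)) :
    (average f E N).prob (fun x => ε / c * m < |x - E f|) ≤ a * c ^ 2 / K := by
  have hpos : 0 < (N : ℝ) * ε ^ 2 := (mul_pos hK hr).trans_le hN
  have ha : 0 ≤ a := nonneg_of_mul_nonneg_left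
    ((E.nonneg fun _ => sq_nonneg _).trans h) (by positivity)
  refine E.prob_average_le f (Nat.cast_pos.1 (pos_of_mul_pos_left hpos (sq_nonneg ε)))
    (by positivity) (h.trans ?_)
  calc a * (r * m ^ 2) = a * (m ^ 2 / K) * (K * r) := by field_simp
    _ ≤ a * (m ^ 2 / K) * (N * ε ^ 2) := by gcongr
    _ = a * c ^ 2 / K * (N * (ε / c * m) ^ 2) := by field_simp

namespace Graph

variable (G : Graph) {t : ℕ}

theorem halfEdge_sq_heaviness_le_one : (G.halfEdge <$> G.uniformDart : Expectation HalfEdge)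
    (fun e => e.heaviness G.n t ^ 2) ≤ 1 :=
  Expectation.le_const _ fun e =>
    pow_le_one₀ (HalfEdge.heaviness_nonneg _ _ e) (HalfEdge.heaviness_le_one _ _ e)

theorem halfEdge_sq_light_le_one : (G.halfEdge <$> G.uniformDart : Expectation HalfEdge)
    (fun e => light G.n t e.degree ^ 2) ≤ 1 :=
  Expectation.le_const _ fun _ => pow_le_one₀ (light_nonneg _ _ _) (light_le_one _ _ _)

theorem pairAverage_pairKernel_sq_le_max (ht : 0 < t) :
    pairAverage (G.pairKernel t) (G.halfEdge <$> G.uniformDart) (1024 * t) (fun z => z ^ 2) ≤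
      3 * max G.avgDeg⁻¹ (t ^ 4 / (1024 ^ 2 * G.n)) ^ 2 := by
  have hd := G.avgDeg_pos
  have hn : (0 : ℝ) < G.n := Nat.cast_pos.2 G.n_pos
  have ht1 : (1 : ℝ) ≤ t := Nat.one_le_cast.2 ht
  set m := max G.avgDeg⁻¹ (t ^ 4 / (1024 ^ 2 * G.n))
  have hdm : G.avgDeg⁻¹ ≤ m := le_max_left _ _
  have hbm : (t : ℝ) ^ 4 / (1024 ^ 2 * G.n) ≤ m := le_max_right _ _
  have hvariance : (t : ℝ) ^ 6 / G.n * G.avgDeg⁻¹ / (1024 * t : ℕ) ^ 2 ≤ m ^ 2 := by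
    calc (t : ℝ) ^ 6 / G.n * G.avgDeg⁻¹ / (1024 * t : ℕ) ^ 2
        = t ^ 4 / (1024 ^ 2 * G.n) * G.avgDeg⁻¹ := by
          push_cast
          field_simp
      _ ≤ m * m := by gcongr
      _ = m ^ 2 := (sq m).symm
  have hcommon : 2 * G.avgDeg⁻¹ ^ 2 / (1024 * t : ℕ) ≤ m ^ 2 := by
    rw [div_le_iff₀ (by positivity)]
    push_cast
    have : G.avgDeg⁻¹ ^ 2 ≤ m ^ 2 := by gcongr
    nlinarith [sq_nonneg m]
  have hmean : (G.heavyFrac t / G.avgDeg) ^ 2 ≤ m ^ 2 := by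
    have := G.heavyFrac_nonneg t
    gcongr
    exact (mul_le_of_le_one_left (by positivity) (G.heavyFrac_le_one t)).trans hdm
  linarith [G.pairAverage_pairKernel_sq_le t (Nat.mul_pos (by norm_num) ht : 0 < 1024 * t)]

section Failure

variable {M R : ℕ} {K ε : ℝ} (hK : 0 < K) (hε : 0 < ε)

include hK hε

theorem prob_invDeg_le (ht : 0 < t) (hM : K * t ≤ M * ε ^ 2) :
    (average (fun e => (e.degree : ℝ)⁻¹) (G.halfEdge <$> G.uniformDart) M).prob
      (fun x => ε / 8 * max G.avgDeg⁻¹ (1 / t) < |x - G.avgDeg⁻¹|) ≤ 1 * 8 ^ 2 / K := by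
  have ht0 : (0 : ℝ) < t := Nat.cast_pos.2 ht
  have hd := G.avgDeg_pos
  rw [← G.uniformDart_inv_deg]
  refine Expectation.prob_average_le_of_sq_le _ hK ht0 hε hM (by norm_num) (by positivity) ?_
  refine G.uniformDart_sq_inv_deg_le.trans ?_
  rw [G.uniformDart_inv_deg]
  calc G.avgDeg⁻¹ = 1 * (t * (1 / t * G.avgDeg⁻¹)) := by field_simp
    _ ≤ 1 * (t * max G.avgDeg⁻¹ (1 / t) ^ 2) := by
      rw [sq]
      gcongr
      exacts [le_max_right _ _, le_max_left _ _]

theorem prob_heavyFrac_le (hR : K ≤ R * ε ^ 2) :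
    (average (HalfEdge.heaviness G.n t) (G.halfEdge <$> G.uniformDart) R).prob
      (fun x => ε / 256 < |x - G.heavyFrac t|) ≤ 1 * 256 ^ 2 / K := by
  simpa only [mul_one] using! Expectation.prob_average_le_of_sq_le _ (r := 1) (m := 1) hK one_pos hε
    (by simpa only [mul_one]) (by norm_num) one_pos
    (by simpa only [mul_one, one_pow] using G.halfEdge_sq_heaviness_le_one)

theorem prob_lightFrac_le (hR : K ≤ R * ε ^ 2) :
    (average (fun e => light G.n t e.degree) (G.halfEdge <$> G.uniformDart) R).prob
      (fun x => ε / 256 < |x - G.lightFrac t|) ≤ 1 * 256 ^ 2 / K := by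
  simpa only [mul_one] using! Expectation.prob_average_le_of_sq_le _ (r := 1) (m := 1) hK one_pos hε
    (by simpa only [mul_one]) (by norm_num) one_pos
    (by simpa only [mul_one, one_pow] using G.halfEdge_sq_light_le_one)

theorem prob_lightDeg_le (ht : 0 < t) (hM : K * t ≤ M * ε ^ 2) :
    (average (fun δ => δ * light G.n t δ) G.uniformDegree M).prob
      (fun y => ε / 8 * max (G.avgDeg * G.lightFrac t) (G.n / t ^ 4) <
        |y - G.avgDeg * G.lightFrac t|) ≤ 1 * 8 ^ 2 / K := by
  have ht0 : (0 : ℝ) < t := Nat.cast_pos.2 ht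
  have hn : (0 : ℝ) < G.n := Nat.cast_pos.2 G.n_pos
  have hmean : 0 ≤ G.avgDeg * G.lightFrac t := mul_nonneg G.avgDeg_pos.le (G.lightFrac_nonneg t)
  rw [← G.uniformDegree_light] at hmean ⊢
  refine Expectation.prob_average_le_of_sq_le _ hK ht0 hε hM (by norm_num) (by positivity) ?_
  refine (G.uniformDegree_sq_light_le t ht).trans ?_
  rw [← G.uniformDegree_light]
  calc _ = 1 * (t * (G.n / t ^ 4 * G.uniformDegree fun δ => δ * light G.n t δ)) := by field_simp
    _ ≤ _ := by
      rw [sq]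
      gcongr
      exacts [le_max_right _ _, le_max_left _ _]

theorem prob_pairs_le (ht : 0 < t) (hR : K ≤ R * ε ^ 2) :
    (average id (pairAverage (G.pairKernel t) (G.halfEdge <$> G.uniformDart) (1024 * t)) R).prob
      (fun z => ε / 256 * max G.avgDeg⁻¹ (t ^ 4 / (1024 ^ 2 * G.n)) <
        |z - G.heavyFrac t / G.avgDeg|) ≤ 3 * 256 ^ 2 / K := by
  have hd := G.avgDeg_pos
  rw [← G.pairAverage_pairKernel t (Nat.mul_pos (by norm_num) ht : 0 < 1024 * t)]
  exact Expectation.prob_average_le_of_sq_le _ (r := 1) hK one_pos hε (by simpa only [mul_one])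
    (by norm_num) (by positivity)
    (by simpa only [one_mul] using! G.pairAverage_pairKernel_sq_le_max ht)

theorem prob_not_accurate_le (ht : 0 < t) (hM : K * t ≤ M * ε ^ 2) (hR : K ≤ R * ε ^ 2) :
    (G.estimates t M R (1024 * t)).prob (fun e => ¬ e.Accurate G t ε) ≤ 400000 / K := by
  calc _ ≤ (1 * 8 ^ 2 / K + (1 * 256 ^ 2 / K + (1 * 256 ^ 2 / K + (1 * 8 ^ 2 / K +
          (3 * 256 ^ 2 / K + 0)))) : ℝ) := by
        refine Expectation.prob_bind_le _ (by positivity)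
          (G.prob_invDeg_le hK hε ht hM) fun x hx => ?_
        refine Expectation.prob_bind_le _ (by positivity)
          (G.prob_heavyFrac_le hK hε hR) fun h hh => ?_
        refine Expectation.prob_bind_le _ (by positivity)
          (G.prob_lightFrac_le hK hε hR) fun f hf => ?_
        refine Expectation.prob_bind_le _ (by positivity)
          (G.prob_lightDeg_le hK hε ht hM) fun y hy => ?_
        refine Expectation.prob_bind_le _ le_rfl (G.prob_pairs_le hK hε ht hR) fun z hz => ?_
        rw [not_lt] at hx hh hf hy hz
        exact (Expectation.prob_pure _ (not_not.2 ⟨hx, hh, hf, hy, hz⟩)).le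
    _ = 327808 / K := by ring
    _ ≤ 400000 / K := by gcongr; norm_num

end Failure

end Graph

theorem isApprox_div {ε a b u v : ℝ} (hε0 : 0 < ε) (hε1 : ε < 1) (ha : 0 < a) (hb : 0 < b)
    (hu : |u - a| ≤ ε / 8 * a) (hv : |v - b| ≤ ε / 8 * b) : IsApprox (1 + ε) (a / b) (u / v) := by
  obtain ⟨hu₁, hu₂⟩ := abs_le.1 hu
  obtain ⟨hv₁, hv₂⟩ := abs_le.1 hv
  have hv0 : 0 < v := by nlinarith
  have hlow : 1 + ε / 8 ≤ (1 - ε / 8) * (1 + ε) := by nlinarith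
  constructor
  · rw [div_div, div_le_div_iff₀ (by positivity) hv0]
    calc a * v ≤ a * ((1 + ε / 8) * b) := by gcongr; linarith
      _ ≤ a * ((1 - ε / 8) * (1 + ε) * b) := by gcongr
      _ = (1 - ε / 8) * a * (b * (1 + ε)) := by ring
      _ ≤ u * (b * (1 + ε)) := by gcongr; linarith
  · rw [← mul_div_assoc, div_le_div_iff₀ hv0 hb]
    calc u * b ≤ (1 + ε / 8) * a * b := by gcongr; linarith
      _ ≤ (1 - ε / 8) * (1 + ε) * a * b := by gcongr
      _ = (1 + ε) * a * ((1 - ε / 8) * b) := by ring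
      _ ≤ (1 + ε) * a * v := by gcongr; linarith

section Guard

variable {ε a b u : ℝ} (hε : ε < 1) (h : |u - a| ≤ ε / 8 * max a b)

include hε h

theorem abs_sub_le_of_two_mul_le (hb : 0 < b) (hu : 2 * b ≤ u) : |u - a| ≤ ε / 8 * a := by
  rcases le_total b a with hab | hab
  · rwa [max_eq_left hab] at h
  · rw [max_eq_right hab] at h
    nlinarith [le_abs_self (u - a)]

theorem two_mul_le_of_four_mul_le (hb : 0 < b) (ha : 4 * b ≤ a) : 2 * b ≤ u := by
  rw [max_eq_left (by linarith)] at h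
  nlinarith [neg_abs_le (u - a)]

end Guard

namespace Estimates

/-- The estimate of the average degree at scale `t`. It is made only if the statistics it uses are
above the level from which on their relative error is small. -/
def avgDeg (e : Estimates) (n t : ℕ) : Option ℝ :=
  if 2 * (1 / t : ℝ) ≤ e.invDeg then some (1 / e.invDeg)
  else if 1 / 16 ≤ e.heavyFrac then
    if 2 * (t ^ 4 / (1024 ^ 2 * n) : ℝ) ≤ e.pairs then some (e.heavyFrac / e.pairs) else none
  else if 2 * (n / t ^ 4 : ℝ) ≤ e.lightDeg then some (e.lightDeg / e.lightFrac) else none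

end Estimates

/-- The scale `t` is of the order of the smaller one of `G.avgDeg` and
`(G.n / G.avgDeg) ^ (1 / 4)`, or larger than the former. -/
def Graph.Fits (G : Graph) (t : ℕ) : Prop :=
  4 * G.avgDeg ≤ t ∨ 256 * G.n ≤ G.avgDeg * t ^ 4 ∧ G.avgDeg * t ^ 4 ≤ 4096 * G.n

namespace Estimates.Accurate

variable {e : Estimates} {G : Graph} {t : ℕ} {ε : ℝ} (h : e.Accurate G t ε) (hε1 : ε < 1)

include h hε1

theorem le_heavyFrac (hheavy : 1 / 16 ≤ e.heavyFrac) : 1 / 32 ≤ G.heavyFrac t := by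
  linarith [(abs_le.1 h.heavyFrac).2]

theorem le_lightFrac (hheavy : e.heavyFrac < 1 / 16) : 1 / 4 ≤ G.lightFrac t := by
  linarith [(abs_le.1 h.heavyFrac).1, G.one_le_heavyFrac_add_lightFrac t]

theorem abs_pairs_sub_le (hε0 : 0 < ε) (hheavy : 1 / 16 ≤ e.heavyFrac) :
    |e.pairs - G.heavyFrac t / G.avgDeg| ≤
      ε / 8 * max (G.heavyFrac t / G.avgDeg) (t ^ 4 / (1024 ^ 2 * G.n)) := by
  have hd := G.avgDeg_pos
  have hfrac := h.le_heavyFrac hε1 hheavy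
  have hb : (0 : ℝ) ≤ t ^ 4 / (1024 ^ 2 * G.n) := by positivity
  refine h.pairs.trans ?_
  rw [show ε / 8 = ε / 256 * 32 by ring, mul_assoc]
  gcongr
  refine max_le ?_ (by
    linarith [le_max_right (G.heavyFrac t / G.avgDeg) (t ^ 4 / (1024 ^ 2 * G.n))])
  calc G.avgDeg⁻¹ ≤ 32 * (G.heavyFrac t / G.avgDeg) := by
        rw [inv_eq_one_div, ← mul_div_assoc]
        gcongr
        linarith
    _ ≤ _ := by gcongr; exact le_max_left _ _

theorem isApprox_of_mem_avgDeg (hε0 : 0 < ε) (ht : 0 < t) {a : ℝ} (ha : a ∈ e.avgDeg G.n t) :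
    IsApprox (1 + ε) G.avgDeg a := by
  have hd := G.avgDeg_pos
  have hn : (0 : ℝ) < G.n := Nat.cast_pos.2 G.n_pos
  have : (0 : ℝ) < t := Nat.cast_pos.2 ht
  unfold Estimates.avgDeg at ha
  split_ifs at ha with hinv hheavy hpairs hlight
  · obtain rfl := Option.some.inj ha
    have happrox := isApprox_div hε0 hε1 one_pos (inv_pos.2 hd) (u := 1)
      (by rw [sub_self, abs_zero]; positivity)
      (abs_sub_le_of_two_mul_le hε1 h.invDeg (by positivity) hinv)
    rwa [one_div, inv_inv] at happrox
  · obtain rfl := Option.some.inj ha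
    have hfrac := h.le_heavyFrac hε1 hheavy
    have happrox := isApprox_div hε0 hε1 (by linarith) (by positivity)
      (h.heavyFrac.trans (by nlinarith))
      (abs_sub_le_of_two_mul_le hε1 (h.abs_pairs_sub_le hε1 hε0 hheavy) (by positivity) hpairs)
    rwa [div_div_cancel₀ (by linarith)] at happrox
  · cases ha
  · obtain rfl := Option.some.inj ha
    have hfrac := h.le_lightFrac hε1 (not_le.1 hheavy)
    have happrox := isApprox_div hε0 hε1 (by positivity) (by linarith)
      (abs_sub_le_of_two_mul_le hε1 h.lightDeg (by positivity) hlight)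
      (h.lightFrac.trans (by nlinarith))
    rwa [mul_div_cancel_right₀ _ (by linarith)] at happrox
  · cases ha

theorem isSome_avgDeg (hε0 : 0 < ε) (ht : 0 < t) (hfits : G.Fits t) :
    (e.avgDeg G.n t).isSome := by
  have hd := G.avgDeg_pos
  have hn : (0 : ℝ) < G.n := Nat.cast_pos.2 G.n_pos
  have ht0 : (0 : ℝ) < t := Nat.cast_pos.2 ht
  unfold Estimates.avgDeg
  split_ifs with hinv hheavy hpairs hlight <;> try rfl
  all_goals
    have hfits' := hfits.resolve_left fun hle => hinv <|
      two_mul_le_of_four_mul_le hε1 h.invDeg (by positivity) (by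
        rw [mul_one_div, inv_eq_one_div, div_le_div_iff₀ ht0 hd]
        linarith)
    exfalso
  · refine hpairs (two_mul_le_of_four_mul_le hε1 (h.abs_pairs_sub_le hε1 hε0 hheavy)
      (by positivity) ?_)
    rw [← mul_div_assoc, div_le_div_iff₀ (by positivity) hd]
    nlinarith [h.le_heavyFrac hε1 hheavy]
  · refine hlight (two_mul_le_of_four_mul_le hε1 h.lightDeg (by positivity) ?_)
    rw [← mul_div_assoc, div_le_iff₀ (by positivity)]
    nlinarith [h.le_lightFrac hε1 (not_le.1 hheavy)]

end Estimates.Accurate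

theorem Realizes.sub_le_hitProb {M : Set Query} {α : Type} {G : Graph} {P : Program M α}
    {E : Expectation α} {c : ℕ} (h : Realizes G P E c) {T : Set ℝ} {k : α → Alg M} {q : ℕ}
    {Bad : α → Prop} {δ y : ℝ} (hy : y ≤ 1) (hBad : E.prob Bad ≤ δ)
    (hk : ∀ a, ¬ Bad a → y ≤ (hitProb G T (k a) q).toReal) :
    y - δ ≤ (hitProb G T (P k) (q + c)).toReal :=
  (E.le_apply_of_prob_le (fun _ => ENNReal.toReal_nonneg) hy hBad hk).trans (h T k q)

section Search

variable {M : Set Query}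

/-- The first answer of the procedures `P j, …, P (j + fuel - 1)`, and `0` if there is none. -/
def search (P : ℕ → Program M (Option ℝ)) : (fuel j : ℕ) → Alg M
  | 0, _ => .ret 0
  | fuel + 1, j => P j fun o => o.elim (search P fuel (j + 1)) .ret

variable {G : Graph} {P : ℕ → Program M (Option ℝ)} {E : ℕ → Expectation (Option ℝ)} {c J : ℕ}
  {T : Set ℝ} {δ : ℝ}

theorem sub_le_hitProb_search (hP : ∀ j ≤ J, Realizes G (P j) (E j) c) (hδ : 0 ≤ δ)
    (hsound : ∀ j, (E j).prob (fun o => ¬ ∀ a ∈ o, a ∈ T) ≤ δ)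
    (hJ : (E J).prob (fun o => ¬ ∃ a ∈ o, a ∈ T) ≤ δ) (i j fuel : ℕ) (hj : j + i = J)
    (hfuel : i < fuel) :
    1 - (i + 1) * δ ≤ (hitProb G T (search P fuel j) ((i + 1) * c)).toReal := by
  have hret {a : ℝ} (ha : a ∈ T) (q : ℕ) : (hitProb G T (.ret a : Alg M) q).toReal = 1 := by
    rw [hitProb_ret, if_pos ha, ENNReal.toReal_one]
  induction i generalizing j fuel with
  | zero =>
    obtain ⟨fuel, rfl⟩ := Nat.exists_eq_add_of_lt hfuel
    obtain rfl : j = J := hj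
    have := (hP j le_rfl).sub_le_hitProb (q := 0) le_rfl hJ
      (k := fun o => o.elim (search P fuel (j + 1)) .ret) fun o ho => by
        obtain ⟨a, rfl, ha⟩ := not_not.1 ho
        exact (hret ha 0).ge
    simpa [search] using this
  | succ i ih =>
    obtain ⟨fuel, rfl⟩ := Nat.exists_eq_succ_of_ne_zero (Nat.ne_zero_of_lt hfuel)
    have := (hP j (by lia)).sub_le_hitProb (q := (i + 1) * c) (y := 1 - (i + 1) * δ)
      (by nlinarith) (hsound j) (k := fun o => o.elim (search P fuel (j + 1)) .ret) fun o ho => by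
        rcases o with _ | a
        · exact ih (j + 1) fuel (by lia) (by lia)
        · exact (hret (not_not.1 ho a rfl) _).symm ▸ (by nlinarith)
    rw [Nat.cast_succ, add_one_mul (i + 1) c, search]
    linarith

end Search

/-- The attempt to estimate the average degree at scale `2 ^ j`. It fails with probability of order
`K⁻¹` if `S` is at least the inverse square of the relative error. -/
def estimate (n K S j : ℕ) : Program advancedModel (Option ℝ) :=
  (fun e => e.avgDeg n (2 ^ j)) <$> measure n (2 ^ j) (K * 2 ^ j * S) (K * S) Program.halfEdge
    Program.vertexDegree (Program.pairs n (2 ^ j) (1024 * 2 ^ j) (10 + j + n.size))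

section Estimate

variable (G : Graph) (K S : ℕ)

theorem realizes_estimate (j : ℕ) : Realizes G (estimate G.n K S j)
    ((fun e => e.avgDeg G.n (2 ^ j)) <$>
      G.estimates (2 ^ j) (K * 2 ^ j * S) (K * S) (1024 * 2 ^ j))
    (10251 * (K * S * 2 ^ j * (10 + j + G.n.size) ^ 2)) := by
  have hB : 1024 * 2 ^ j * G.n < 2 ^ (10 + j + G.n.size) := by
    rw [pow_add, pow_add]
    exact Nat.mul_lt_mul_of_pos_left G.n.lt_size_self (by positivity)
  refine Realizes.map _ (((Program.realizes_halfEdge G).measure (Program.realizes_vertexDegree G)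
    (Program.realizes_pairs G hB) _ _ _ _).mono ?_)
  have hB1 : 1 ≤ (10 + j + G.n.size) ^ 2 := Nat.one_le_pow _ _ (by lia)
  have ht : 1 ≤ 2 ^ j := Nat.one_le_two_pow
  calc _ = K * S * (2 ^ j * (6149 + 4096 * (10 + j + G.n.size) ^ 2) + 6 * 1) := by ring
    _ ≤ K * S * (2 ^ j * (6149 * (10 + j + G.n.size) ^ 2 + 4096 * (10 + j + G.n.size) ^ 2) +
        6 * (2 ^ j * (10 + j + G.n.size) ^ 2)) := by
          gcongr
          · lia
          · exact Nat.mul_pos ht hB1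
    _ = _ := by ring

theorem sub_le_hitProb_estimate {ε : ℝ} (hε0 : 0 < ε) (hε1 : ε < 1) (hK : 0 < K)
    (hS : 1 ≤ S * ε ^ 2) {j fuel : ℕ} (hfits : G.Fits (2 ^ j)) (hj : j < fuel) :
    1 - (j + 1) * (400000 / K) ≤
      (hitProb G {a | IsApprox (1 + ε) G.avgDeg a} (search (estimate G.n K S) fuel 0)
        ((j + 1) * (10251 * (K * S * 2 ^ j * (10 + j + G.n.size) ^ 2)))).toReal := by
  have hbad (i : ℕ) := G.prob_not_accurate_le (t := 2 ^ i) (M := K * 2 ^ i * S) (R := K * S)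
    (Nat.cast_pos.2 hK) hε0 (by positivity)
    (by push_cast; rw [mul_assoc _ (S : ℝ)]; exact le_mul_of_one_le_right (by positivity) hS)
    (by push_cast; rw [mul_assoc]; exact le_mul_of_one_le_right (by positivity) hS)
  have hcost {i : ℕ} (hi : i ≤ j) :
      K * S * 2 ^ i * (10 + i + G.n.size) ^ 2 ≤ K * S * 2 ^ j * (10 + j + G.n.size) ^ 2 := by
    gcongr
    exact one_le_two
  refine sub_le_hitProb_search (J := j)
    (fun i hi => (realizes_estimate G K S i).mono (Nat.mul_le_mul_left _ (hcost hi)))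
    (by positivity) (fun i => ?_) ?_ j 0 fuel (zero_add j) hj
  · rw [Expectation.prob_map]
    refine (Expectation.prob_mono _ fun e => ?_).trans (hbad i)
    exact mt fun h a => h.isApprox_of_mem_avgDeg hε1 hε0 (by positivity)
  · rw [Expectation.prob_map]
    refine (Expectation.prob_mono _ fun e => ?_).trans (hbad j)
    refine mt fun h => ?_
    obtain ⟨a, ha⟩ := Option.isSome_iff_exists.1 (h.isSome_avgDeg hε1 hε0 (by positivity) hfits)
    exact ⟨a, ha, h.isApprox_of_mem_avgDeg hε1 hε0 (by positivity) ha⟩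

end Estimate

theorem Graph.exists_fits (G : Graph) :
    ∃ j, G.Fits (2 ^ j) ∧ (2 : ℝ) ^ j ≤ 8 * min G.avgDeg ((G.n / G.avgDeg) ^ (1 / 4 : ℝ)) := by
  have hd := G.avgDeg_pos
  have hquot : 1 ≤ G.n / G.avgDeg := (one_le_div hd).2 G.avgDeg_le
  have hroot : ((G.n / G.avgDeg) ^ (1 / 4 : ℝ)) ^ 4 = G.n / G.avgDeg := by
    rw [← Real.rpow_natCast, ← Real.rpow_mul (by positivity)]
    norm_num
  obtain ⟨m, hm, hm'⟩ := exists_nat_pow_near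
    (le_min G.one_le_avgDeg (Real.one_le_rpow hquot (by norm_num : (0 : ℝ) ≤ 1 / 4))) one_lt_two
  refine ⟨m + 3, ?_, by rw [pow_add]; linarith⟩
  rcases min_choice G.avgDeg ((G.n / G.avgDeg) ^ (1 / 4 : ℝ)) with h | h <;> rw [h] at hm hm'
  · refine .inl ?_
    push_cast
    rw [pow_succ] at hm'
    rw [pow_add]
    linarith
  · have hle : ((2 : ℝ) ^ m) ^ 4 ≤ G.n / G.avgDeg :=
      (pow_le_pow_left₀ (pow_nonneg zero_le_two m) hm 4).trans_eq hroot
    have hge : G.n / G.avgDeg ≤ ((2 : ℝ) ^ (m + 1)) ^ 4 :=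
      hroot.symm.trans_le (pow_le_pow_left₀ (Real.rpow_nonneg (by positivity) _) hm'.le 4)
    rw [le_div_iff₀' hd] at hle
    rw [div_le_iff₀' hd, pow_succ (2 : ℝ) m, mul_pow] at hge
    refine .inr ?_
    push_cast
    rw [pow_add, mul_pow]
    constructor <;> linarith

theorem size_le_four_mul_log {n : ℕ} (hn : 2 ≤ n) : (n.size : ℝ) ≤ 4 * Real.log n := by
  obtain ⟨l, hl⟩ : ∃ l, n.size = l + 1 :=
    Nat.exists_eq_succ_of_ne_zero (Nat.size_pos.2 (by lia)).ne'
  have hl1 : (1 : ℝ) ≤ l := by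
    have : 1 < n.size := Nat.lt_size.2 hn
    exact Nat.one_le_cast.2 (by lia)
  have hpow : (2 : ℝ) ^ l ≤ n := by
    exact_mod_cast Nat.lt_size.1 (l.lt_succ_self.trans_eq hl.symm)
  have hlog : l * Real.log 2 ≤ Real.log n := by
    rw [← Real.log_pow]
    exact Real.log_le_log (by positivity) hpow
  rw [hl]
  push_cast
  nlinarith [Real.log_two_gt_d9]

/-- The algorithm that tries the scales `1, 2, 4, …` one after the other. -/
def avgDegAlg (n : ℕ) (ε : ℝ) : Alg advancedModel :=
  search (estimate n (2 * 10 ^ 8 * n.size) ⌈ε⁻¹ ^ 2⌉₊) (n.size + 3) 0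

theorem lt_size_add_three (G : Graph) {j : ℕ} (hj : (2 : ℝ) ^ j ≤ 8 * G.avgDeg) :
    j < G.n.size + 3 := by
  have hjn : (2 : ℝ) ^ j ≤ 8 * G.n := hj.trans (by linarith [G.avgDeg_le])
  have hlt : 2 ^ j < 2 ^ (G.n.size + 3) := by
    calc 2 ^ j ≤ 8 * G.n := by exact_mod_cast hjn
      _ < 2 ^ (G.n.size + 3) := by
        have := G.n.lt_size_self
        rw [pow_add]
        lia
  exact (Nat.pow_lt_pow_iff_right one_lt_two).1 hlt

theorem search_cost_le {L S j : ℕ} {l e μ : ℝ} (hL : 2 ≤ L) (hLl : L ≤ 4 * l) (hS : S ≤ 2 * e)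
    (hj : j < L + 3) (hμ : 2 ^ j ≤ 8 * μ) :
    (((j + 1) * (10251 * (2 * 10 ^ 8 * L * S * 2 ^ j * (10 + j + L) ^ 2)) : ℕ) : ℝ) ≤
      10 ^ 19 * l ^ 4 * (e * μ) := by
  have he : 0 ≤ e := by linarith [(Nat.cast_nonneg S : (0 : ℝ) ≤ S)]
  have hμ0 : 0 ≤ μ := by linarith [pow_pos (zero_lt_two' ℝ) j]
  have hsteps : j + 1 ≤ 3 * L := by lia
  have hbits : 10 + j + L ≤ 8 * L := by lia
  calc _ ≤ (((3 * L) * (10251 * (2 * 10 ^ 8 * L * S * 2 ^ j * (8 * L) ^ 2)) : ℕ) : ℝ) := by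
        gcongr
    _ = 3 * 10251 * (2 * 10 ^ 8) * 64 * L ^ 4 * (S * 2 ^ j) := by push_cast; ring
    _ ≤ 3 * 10251 * (2 * 10 ^ 8) * 64 * (4 * l) ^ 4 * (2 * e * (8 * μ)) := by gcongr
    _ = 3 * 10251 * (2 * 10 ^ 8) * 64 * 4 ^ 4 * 16 * (l ^ 4 * (e * μ)) := by ring
    _ ≤ 10 ^ 19 * (l ^ 4 * (e * μ)) := by gcongr; norm_num
    _ = _ := by ring

theorem query_upper_bound {n : ℕ} {ε : ℝ} (hε0 : 0 < ε) (hε1 : ε < 1) (G : Graph) (hG : G.n = n) :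
    99 / 100 < successProb (avgDegAlg n ε) G (1 + ε) (10 ^ 19 * Real.log n ^ 4 *
      (ε⁻¹ ^ 2 * min G.avgDeg ((n / G.avgDeg) ^ (1 / 4 : ℝ)))) := by
  subst hG
  have hL : 2 ≤ G.n.size := Nat.lt_size.2 G.two_le_n
  have hεinv : 1 ≤ ε⁻¹ ^ 2 := one_le_pow₀ ((one_le_inv₀ hε0).2 hε1.le)
  have hS : (⌈ε⁻¹ ^ 2⌉₊ : ℝ) ≤ 2 * ε⁻¹ ^ 2 := by
    linarith [Nat.ceil_lt_add_one (zero_le_one.trans hεinv)]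
  have hSε : 1 ≤ ⌈ε⁻¹ ^ 2⌉₊ * ε ^ 2 := by
    rw [← div_le_iff₀ (by positivity), one_div, ← inv_pow]
    exact Nat.le_ceil _
  obtain ⟨j, hfits, hμ⟩ := G.exists_fits
  have hj := lt_size_add_three G (hμ.trans (by gcongr; exact min_le_left _ _))
  have hcost := search_cost_le hL (size_le_four_mul_log G.two_le_n) hS hj hμ
  have hsucc := sub_le_hitProb_estimate G (2 * 10 ^ 8 * G.n.size) ⌈ε⁻¹ ^ 2⌉₊ hε0 hε1
    (by positivity) hSε hfits hj
  rw [successProb_eq_hitProb _ _ _ (le_trans (Nat.cast_nonneg _) hcost)]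
  refine lt_of_lt_of_le ?_ (hitProb_mono G _ _ (Nat.le_floor hcost))
  rw [← ENNReal.toReal_lt_toReal (by simp [ENNReal.div_eq_top]) (hitProb_ne_top _ _ _ _)]
  refine lt_of_lt_of_le ?_ hsucc
  have hfail : (j + 1 : ℝ) * (400000 / (2 * 10 ^ 8 * G.n.size : ℕ)) ≤ 3 / 500 := by
    have hsteps : (j + 1 : ℝ) ≤ 3 * G.n.size := by exact_mod_cast (by lia : j + 1 ≤ 3 * G.n.size)
    have : (0 : ℝ) < G.n.size := by positivity
    push_cast
    rw [← mul_div_assoc, div_le_iff₀ (by positivity)]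
    linarith
  rw [ENNReal.toReal_div]
  norm_num only [ENNReal.toReal_ofNat] at hfail ⊢
  linarith

theorem min_le_rpow {n d : ℝ} (hn : 0 < n) (hd : 0 < d) :
    min d ((n / d) ^ (1 / 4 : ℝ)) ≤ n ^ (1 / 5 : ℝ) := by
  rcases le_total d (n ^ (1 / 5 : ℝ)) with h | h
  · exact (min_le_left _ _).trans h
  · refine (min_le_right _ _).trans ?_
    calc (n / d) ^ (1 / 4 : ℝ) ≤ (n / n ^ (1 / 5 : ℝ)) ^ (1 / 4 : ℝ) := by gcongr
      _ = n ^ (1 / 5 : ℝ) := by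
          nth_rewrite 1 [← Real.rpow_one n]
          rw [← Real.rpow_sub hn, ← Real.rpow_mul hn.le]
          norm_num

section Cliques

/-- The labels `Nat.pair b i` with `i < m`, the vertices of a clique of size `m` that is placed in
the block `b` of the label space. -/
def block (b m : ℕ) : Finset ℕ := (Finset.range m).image (Nat.pair b)

/-- The edges of the complete graph on `S`. -/
def cliqueEdges (S : Finset ℕ) : Finset (Sym2 ℕ) := S.offDiag.image (Function.uncurry Sym2.mk)

theorem mem_block {b m x : ℕ} : x ∈ block b m ↔ x.unpair.1 = b ∧ x.unpair.2 < m := by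
  simp only [block, Finset.mem_image, Finset.mem_range]
  constructor
  · rintro ⟨i, hi, rfl⟩
    simp [hi]
  · rintro ⟨rfl, hx⟩
    exact ⟨_, hx, Nat.pair_unpair x⟩

theorem card_block (b m : ℕ) : (block b m).card = m := by
  rw [block, Finset.card_image_of_injective _ fun _ _ h => (Nat.pair_eq_pair.1 h).2,
    Finset.card_range]

theorem disjoint_block {b b' : ℕ} (h : b ≠ b') (m m' : ℕ) : Disjoint (block b m) (block b' m') :=
  Finset.disjoint_left.2 fun _ hx hx' => h ((mem_block.1 hx).1.symm.trans (mem_block.1 hx').1)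

theorem mk_mem_cliqueEdges {S : Finset ℕ} {x y : ℕ} :
    s(x, y) ∈ cliqueEdges S ↔ x ∈ S ∧ y ∈ S ∧ x ≠ y := by
  simp only [cliqueEdges, Finset.mem_image, Finset.mem_offDiag, Prod.exists,
    Function.uncurry_apply_pair, Sym2.eq_iff]
  aesop

theorem card_cliqueEdges (S : Finset ℕ) : (cliqueEdges S).card = S.card.choose 2 :=
  Sym2.card_image_offDiag S

theorem disjoint_cliqueEdges {S S' : Finset ℕ} (h : Disjoint S S') :
    Disjoint (cliqueEdges S) (cliqueEdges S') := by
  refine Finset.disjoint_left.2 fun e => Sym2.inductionOn e fun x y hx hx' => ?_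
  exact Finset.disjoint_left.1 h (mk_mem_cliqueEdges.1 hx).1 (mk_mem_cliqueEdges.1 hx').1

end Cliques

/-- A disjoint union of at most `U` cliques with at least two vertices each, at most one in each of
the blocks `0, …, U - 1`; an empty block has size `0`. -/
structure CliqueUnion (U : ℕ) where
  size : Fin U → ℕ
  size_ne_one : ∀ b, size b ≠ 1
  exists_size_ne_zero : ∃ b, size b ≠ 0

namespace CliqueUnion

variable {U : ℕ} (c : CliqueUnion U)

/-- The clique in the block `b`. -/
def clique (b : Fin U) : Finset ℕ := block b (c.size b)

theorem disjoint_clique {b b' : Fin U} (h : b ≠ b') : Disjoint (c.clique b) (c.clique b') :=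
  disjoint_block (Fin.val_ne_of_ne h) _ _

/-- The underlying input graph. -/
def toGraph : Graph where
  verts := Finset.univ.biUnion c.clique
  toSimple :=
    { Adj := fun x y => x ≠ y ∧ ∃ b, x ∈ c.clique b ∧ y ∈ c.clique b
      symm := ⟨fun _ _ h => ⟨h.1.symm, h.2.imp fun _ => And.symm⟩⟩
      loopless := ⟨fun _ h => h.1 rfl⟩ }
  nonempty := by
    obtain ⟨b, hb⟩ := c.exists_size_ne_zero
    obtain ⟨x, hx⟩ : (c.clique b).Nonempty :=
      Finset.card_ne_zero.1 ((card_block b _).trans_ne hb)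
    exact ⟨x, Finset.mem_biUnion.2 ⟨b, Finset.mem_univ b, hx⟩⟩
  mem_of_adj := fun _ _ h =>
    h.2.elim fun b hb => Finset.mem_biUnion.2 ⟨b, Finset.mem_univ b, hb.1⟩
  exists_adj := by
    intro x hx
    obtain ⟨b, -, hxb⟩ := Finset.mem_biUnion.1 hx
    have hpos : 0 < (c.clique b).card := Finset.card_pos.2 ⟨x, hxb⟩
    have hone : (c.clique b).card ≠ 1 := (card_block b _).symm ▸ c.size_ne_one b
    obtain ⟨y, hy, hyx⟩ := Finset.exists_mem_ne (by omega : 1 < (c.clique b).card) x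
    exact ⟨y, hyx.symm, b, hxb, hy⟩

theorem verts_toGraph : c.toGraph.verts = Finset.univ.biUnion c.clique := rfl

theorem toGraph_adj {x y : ℕ} :
    c.toGraph.toSimple.Adj x y ↔ x ≠ y ∧ ∃ b, x ∈ c.clique b ∧ y ∈ c.clique b := Iff.rfl

theorem edges_toGraph :
    c.toGraph.edges = Finset.univ.biUnion fun b => cliqueEdges (c.clique b) := by
  ext e
  induction e using Sym2.inductionOn with | _ x y
  simp only [Graph.edges, Graph.mk_mem_edgesIn, toGraph_adj, verts_toGraph, Finset.mem_biUnion,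
    Finset.mem_univ, true_and, mk_mem_cliqueEdges]
  constructor
  · rintro ⟨-, hxy, b, hx, hy⟩
    exact ⟨b, hx, hy, hxy⟩
  · rintro ⟨b, hx, hy, hxy⟩
    exact ⟨⟨⟨b, hx⟩, b, hy⟩, hxy, b, hx, hy⟩

theorem n_toGraph : c.toGraph.n = ∑ b, c.size b := by
  rw [Graph.n, verts_toGraph, Finset.card_biUnion fun _ _ _ _ h => c.disjoint_clique h]
  exact Finset.sum_congr rfl fun b _ => card_block b _

theorem card_edges_toGraph : c.toGraph.edges.card = ∑ b, (c.size b).choose 2 := by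
  rw [edges_toGraph,
    Finset.card_biUnion fun _ _ _ _ h => disjoint_cliqueEdges (c.disjoint_clique h)]
  exact Finset.sum_congr rfl fun b _ => by rw [card_cliqueEdges, clique, card_block]

end CliqueUnion

section Locality

/-- The labels a query refers to. -/
def Query.labels : Query → Finset ℕ
  | .randVert => ∅
  | .randEdge => ∅
  | .randNbr x => {x}
  | .degree x => {x}
  | .additive S => S
  | .fullNbr x => {x}

/-- The blocks a query refers to. -/
def Query.blocks (q : Query) (U : ℕ) : Finset (Fin U) :=
  Finset.univ.filter fun b => (b : ℕ) ∈ q.labels.image fun x => x.unpair.1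

theorem Query.card_blocks_le (q : Query) (U : ℕ) : (q.blocks U).card ≤ q.cost := by
  have card_labels : q.labels.card ≤ q.cost := by cases q <;> simp [labels, cost]
  exact (Finset.card_le_card_of_injOn Fin.val (fun b hb => (Finset.mem_filter.1 hb).2)
    Fin.val_injective.injOn).trans (Finset.card_image_le.trans card_labels)

variable {U : ℕ} {c d : CliqueUnion U}

theorem CliqueUnion.adj_congr {x : ℕ} (h : ∀ b : Fin U, x.unpair.1 = b → c.size b = d.size b)
    (y : ℕ) : c.toGraph.toSimple.Adj x y ↔ d.toGraph.toSimple.Adj x y := by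
  simp only [toGraph_adj]
  refine and_congr_right fun _ => exists_congr fun b => ?_
  by_cases hb : x.unpair.1 = b
  · rw [clique, clique, h b hb]
  · simp [clique, mem_block, hb]

theorem CliqueUnion.nbrs_congr {x : ℕ} (h : ∀ b : Fin U, x.unpair.1 = b → c.size b = d.size b) :
    c.toGraph.nbrs x = d.toGraph.nbrs x := by
  ext y
  have mem_nbrs (G : Graph) : y ∈ G.nbrs x ↔ G.toSimple.Adj x y := by
    simp only [Graph.nbrs, Finset.mem_filter, and_iff_right_iff_imp]
    exact fun hxy => G.mem_of_adj y x hxy.symm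
  rw [mem_nbrs, mem_nbrs, adj_congr h]

theorem CliqueUnion.edgesIn_congr {S : Finset ℕ}
    (h : ∀ x ∈ S, ∀ b : Fin U, x.unpair.1 = b → c.size b = d.size b) :
    c.toGraph.edgesIn S = d.toGraph.edgesIn S := by
  ext e
  induction e using Sym2.inductionOn with | _ x y
  rw [Graph.mk_mem_edgesIn, Graph.mk_mem_edgesIn]
  exact and_congr_right fun hS => adj_congr (h x hS.1) y

theorem CliqueUnion.answer_congr {q : Query} (hV : q ≠ .randVert) (hE : q ≠ .randEdge)
    (h : ∀ b ∈ q.blocks U, c.size b = d.size b) : c.toGraph.answer q = d.toGraph.answer q := by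
  have agree {x : ℕ} (hx : x ∈ q.labels) (b : Fin U) (hb : x.unpair.1 = b) :
      c.size b = d.size b :=
    h b (Finset.mem_filter.2 ⟨Finset.mem_univ b, Finset.mem_image.2 ⟨x, hx, hb⟩⟩)
  cases q with
  | randVert => exact absurd rfl hV
  | randEdge => exact absurd rfl hE
  | randNbr x => simp only [Graph.answer, nbrs_congr (agree (Finset.mem_singleton_self x))]
  | degree x => simp only [Graph.answer, nbrs_congr (agree (Finset.mem_singleton_self x))]
  | additive S =>
    have hS : c.toGraph.edgesIn S = d.toGraph.edgesIn S := edgesIn_congr fun x hx => agree hx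
    simp only [Graph.answer, hS]
  | fullNbr x => simp only [Graph.answer, nbrs_congr (agree (Finset.mem_singleton_self x))]

end Locality

namespace CliqueUnion

variable {U : ℕ} (m c : CliqueUnion U)

/-- The empty blocks. -/
def fresh : Finset (Fin U) := Finset.univ.filter fun b => c.size b = 0

/-- The nonempty blocks. -/
def revealed : Finset (Fin U) := Finset.univ.filter fun b => c.size b ≠ 0

/-- `c` with a clique of size `j` placed in the block `b`. -/
def reveal (b : Fin U) {j : ℕ} (hj : 1 < j) : CliqueUnion U where
  size := Function.update c.size b j
  size_ne_one b' := by
    rw [Function.update_apply]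
    split_ifs
    exacts [hj.ne', c.size_ne_one b']
  exists_size_ne_zero := ⟨b, by rw [Function.update_self]; omega⟩

/-- `m` with its blocks permuted. -/
def permute (σ : Equiv.Perm (Fin U)) : CliqueUnion U where
  size := m.size ∘ σ
  size_ne_one b := m.size_ne_one (σ b)
  exists_size_ne_zero :=
    m.exists_size_ne_zero.imp' σ.symm fun b hb => by rwa [Function.comp, σ.apply_symm_apply]

/-- The permutations of `m` that contain all cliques of `c`: the inputs that are consistent with
what an algorithm has seen so far. -/
def extensions : Finset (Equiv.Perm (Fin U)) :=
  Finset.univ.filter fun σ => ∀ b, c.size b ≠ 0 → m.size (σ b) = c.size b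

theorem mem_fresh {b : Fin U} : b ∈ c.fresh ↔ c.size b = 0 := by
  simp only [fresh, Finset.mem_filter, Finset.mem_univ, true_and]

theorem mem_revealed {b : Fin U} : b ∈ c.revealed ↔ c.size b ≠ 0 := by
  simp only [revealed, Finset.mem_filter, Finset.mem_univ, true_and]

theorem mem_extensions {σ : Equiv.Perm (Fin U)} :
    σ ∈ m.extensions c ↔ ∀ b, c.size b ≠ 0 → m.size (σ b) = c.size b := by
  simp only [extensions, Finset.mem_filter, Finset.mem_univ, true_and]

theorem card_fresh : c.fresh.card = U - c.revealed.card := by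
  have := Finset.card_filter_add_card_filter_not (s := Finset.univ) fun b : Fin U => c.size b = 0
  rw [Finset.card_univ, Fintype.card_fin] at this
  exact Nat.eq_sub_of_add_eq this

theorem card_revealed_reveal_le (b : Fin U) {j : ℕ} (hj : 1 < j) :
    (c.reveal b hj).revealed.card ≤ c.revealed.card + 1 := by
  refine (Finset.card_le_card fun b' hb' => ?_).trans (Finset.card_insert_le b c.revealed)
  by_cases h : b' = b
  · exact Finset.mem_insert.2 (.inl h)
  · simp only [mem_revealed, reveal, Function.update_of_ne h] at hb'
    exact Finset.mem_insert_of_mem (c.mem_revealed.2 hb')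

theorem extensions_reveal {b : Fin U} (hb : b ∈ c.fresh) {j : ℕ} (hj : 1 < j) :
    m.extensions (c.reveal b hj) = (m.extensions c).filter fun σ => m.size (σ b) = j := by
  ext σ
  have hb0 := c.mem_fresh.1 hb
  simp only [Finset.mem_filter, mem_extensions, reveal]
  constructor
  · intro h
    refine ⟨fun b' hb' => ?_, by simpa [(zero_lt_one.trans hj).ne'] using h b⟩
    have hne : b' ≠ b := by rintro rfl; exact hb' hb0
    simpa [hne, hb'] using h b'
  · rintro ⟨h, hj'⟩ b' hb'
    rcases eq_or_ne b' b with rfl | hne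
    · rwa [Function.update_self]
    · rw [Function.update_of_ne hne] at hb' ⊢
      exact h b' hb'

theorem mul_swap_mem_extensions {b b' : Fin U} (hb : b ∈ c.fresh) (hb' : b' ∈ c.fresh)
    {σ : Equiv.Perm (Fin U)} (hσ : σ ∈ m.extensions c) :
    σ * Equiv.swap b b' ∈ m.extensions c := by
  rw [mem_fresh] at hb hb'
  rw [mem_extensions] at hσ ⊢
  intro x hx
  have hxb : x ≠ b := by rintro rfl; exact hx hb
  have hxb' : x ≠ b' := by rintro rfl; exact hx hb'
  rw [Equiv.Perm.mul_apply, Equiv.swap_apply_of_ne_of_ne hxb hxb', hσ x hx]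

theorem card_filter_extensions_eq (P : Fin U → Prop) [DecidablePred P] {b b' : Fin U}
    (hb : b ∈ c.fresh) (hb' : b' ∈ c.fresh) :
    ((m.extensions c).filter fun σ => P (σ b)).card =
      ((m.extensions c).filter fun σ => P (σ b')).card := by
  refine Finset.card_nbij' (· * Equiv.swap b b') (· * Equiv.swap b b') ?_ ?_ ?_ ?_
  all_goals
    intro σ hσ
    simp only [Finset.coe_filter, Set.mem_ofPred_eq] at hσ ⊢
  · exact ⟨m.mul_swap_mem_extensions c hb hb' hσ.1, by simpa using hσ.2⟩
  · exact ⟨m.mul_swap_mem_extensions c hb hb' hσ.1, by simpa using hσ.2⟩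
  · rw [mul_assoc, Equiv.swap_mul_self, mul_one]
  · rw [mul_assoc, Equiv.swap_mul_self, mul_one]

/-- By symmetry the contents of a fresh block are those of a uniformly random fresh block. -/
theorem card_fresh_mul_card_filter_le (P : Fin U → Prop) [DecidablePred P] {b : Fin U}
    (hb : b ∈ c.fresh) :
    c.fresh.card * ((m.extensions c).filter fun σ => P (σ b)).card ≤
      (m.extensions c).card * (Finset.univ.filter P).card := by
  calc c.fresh.card * ((m.extensions c).filter fun σ => P (σ b)).card
      = ∑ b' ∈ c.fresh, ((m.extensions c).filter fun σ => P (σ b')).card := by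
        rw [Finset.sum_congr rfl fun b' hb' => m.card_filter_extensions_eq c P hb' hb,
          Finset.sum_const, smul_eq_mul]
    _ = ∑ σ ∈ m.extensions c, (c.fresh.filter fun b' => P (σ b')).card := by
        simp only [Finset.card_filter]
        exact Finset.sum_comm
    _ ≤ ∑ _σ ∈ m.extensions c, (Finset.univ.filter P).card := by
        refine Finset.sum_le_sum fun σ _ =>
          Finset.card_le_card_of_injOn σ (fun b' hb' => ?_) σ.injective.injOn
        exact Finset.mem_filter.2 ⟨Finset.mem_univ _, (Finset.mem_filter.1 hb').2⟩
    _ = (m.extensions c).card * (Finset.univ.filter P).card := by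
        rw [Finset.sum_const, smul_eq_mul]

theorem sum_size_permute {M : Type*} [AddCommMonoid M] (F : ℕ → M) (σ : Equiv.Perm (Fin U)) :
    ∑ b, F ((m.permute σ).size b) = ∑ b, F (m.size b) :=
  Equiv.sum_comp σ fun b => F (m.size b)

end CliqueUnion

section BlockSampling

/-- The description of the answers to a sampling query on disjoint unions of cliques: they are
uniform among the union of the parts `part b i`, where `b` runs through the blocks and `i` is the
size of the clique in `b`. -/
structure BlockSampling (q : Query) where
  part : ℕ → ℕ → Finset q.Answer
  weight : ℕ → ℕ
  card_part : ∀ b i, (part b i).card = weight i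
  mean_answer : ∀ {U : ℕ} (c : CliqueUnion U) (f : q.Answer → ℝ≥0∞),
    mean (c.toGraph.answer q) f =
      ((∑ b, weight (c.size b) : ℕ) : ℝ≥0∞)⁻¹ * ∑ b : Fin U, ∑ a ∈ part b (c.size b), f a

/-- Random vertices fall into a clique with probability proportional to its size. -/
def vertSampling : BlockSampling .randVert where
  part := block
  weight i := i
  card_part := card_block
  mean_answer c f := by
    rw [Graph.answer, mean_uniformOfFinset, ← Graph.n, c.n_toGraph, c.verts_toGraph,
      Finset.sum_biUnion fun _ _ _ _ h => c.disjoint_clique h]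
    rfl

/-- Random edges fall into a clique with probability proportional to its number of edges. -/
def edgeSampling : BlockSampling .randEdge where
  part b i := cliqueEdges (block b i)
  weight i := i.choose 2
  card_part b i := by rw [card_cliqueEdges, card_block]
  mean_answer c f := by
    rw [Graph.answer, mean_uniformOfFinset, c.card_edges_toGraph, c.edges_toGraph,
      Finset.sum_biUnion fun _ _ _ _ h => disjoint_cliqueEdges (c.disjoint_clique h)]
    rfl

namespace BlockSampling

variable {q : Query} (S : BlockSampling q) {U : ℕ} (c : CliqueUnion U) {j : ℕ} (hj : 1 < j)

/-- The simulated answer to a sampling query when `c` is known: a uniform element of a clique of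
size `j` in a uniformly random fresh block. The value is the expectation of `f` over the answer
and the updated knowledge. -/
def simMean (f : q.Answer → CliqueUnion U → ℝ≥0∞) : ℝ≥0∞ :=
  ((S.weight j * c.fresh.card : ℕ) : ℝ≥0∞)⁻¹ *
    ∑ b ∈ c.fresh, ∑ a ∈ S.part b j, f a (c.reveal b hj)

theorem simMean_add (f g : q.Answer → CliqueUnion U → ℝ≥0∞) :
    S.simMean c hj (fun a d => f a d + g a d) = S.simMean c hj f + S.simMean c hj g := by
  simp only [simMean, Finset.sum_add_distrib, mul_add]

theorem simMean_mono {f g : q.Answer → CliqueUnion U → ℝ≥0∞} (h : ∀ a d, f a d ≤ g a d) :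
    S.simMean c hj f ≤ S.simMean c hj g :=
  mul_le_mul_right (Finset.sum_le_sum fun _ _ => Finset.sum_le_sum fun _ _ => h _ _) _

theorem simMean_const_le (r : ℝ≥0∞) : S.simMean c hj (fun _ _ => r) ≤ r := by
  have sum_const : ∑ b ∈ c.fresh, ∑ _a ∈ S.part b j, r =
      ((S.weight j * c.fresh.card : ℕ) : ℝ≥0∞) * r := by
    simp only [Finset.sum_const, S.card_part, nsmul_eq_mul]
    push_cast
    ring
  rw [simMean, sum_const, ← mul_assoc]
  exact mul_le_of_le_one_left' (ENNReal.inv_mul_le_one _)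

end BlockSampling

end BlockSampling

namespace BlockSampling

variable {q : Query} (S : BlockSampling q) {U : ℕ} (m c : CliqueUnion U) {j : ℕ} (hj : 1 < j)
  {Q : ℕ} {η : ℝ≥0∞}

/-- Up to probability `η` a sample from a permutation of `m` lies in a clique of size `j` that is
not among `Q` already known ones. -/
structure MostlyFresh (S : BlockSampling q) (m : CliqueUnion U) (j Q : ℕ) (η : ℝ≥0∞) : Prop where
  weight_pos : 0 < S.weight j
  exists_size_eq : ∃ b, m.size b = j
  sum_le : ((∑ b with m.size b ≠ j, S.weight (m.size b) + Q * S.weight j : ℕ) : ℝ≥0∞) ≤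
    η * (∑ b, S.weight (m.size b) : ℕ)

theorem card_mul_weight_le :
    (Finset.univ.filter fun b => m.size b = j).card * S.weight j ≤ ∑ b, S.weight (m.size b) := by
  rw [← smul_eq_mul, ← Finset.sum_const,
    Finset.sum_congr rfl fun b hb => by rw [← (Finset.mem_filter.1 hb).2]]
  exact Finset.sum_le_sum_of_subset (Finset.filter_subset _ _)

theorem sum_part_permute_le (σ : Equiv.Perm (Fin U)) {f : q.Answer → ℝ≥0∞}
    (hf : ∀ a, f a ≤ 1) :
    ∑ b : Fin U, ∑ a ∈ S.part b ((m.permute σ).size b), f a ≤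
      ∑ b ∈ c.fresh with m.size (σ b) = j, ∑ a ∈ S.part b j, f a +
        (∑ b with m.size b ≠ j, S.weight (m.size b) + c.revealed.card * S.weight j : ℕ) := by
  have part_le (b i : ℕ) : ∑ a ∈ S.part b i, f a ≤ S.weight i := by
    calc ∑ a ∈ S.part b i, f a ≤ ∑ _a ∈ S.part b i, 1 := Finset.sum_le_sum fun a _ => hf a
      _ = S.weight i := by rw [Finset.sum_const, S.card_part, nsmul_one]
  have sum_ne : ∑ b with m.size b ≠ j, S.weight (m.size b) =
      ∑ b, if m.size (σ b) ≠ j then S.weight (m.size (σ b)) else 0 := by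
    rw [Finset.sum_filter]
    exact (Equiv.sum_comp σ fun b => if m.size b ≠ j then S.weight (m.size b) else 0).symm
  have sum_revealed : c.revealed.card * S.weight j =
      ∑ b, if c.size b ≠ 0 then S.weight j else 0 := by
    rw [← Finset.sum_filter, Finset.sum_const, smul_eq_mul]
    rfl
  rw [sum_ne, sum_revealed, CliqueUnion.fresh, Finset.filter_filter, Finset.sum_filter]
  push_cast
  rw [← Finset.sum_add_distrib, ← Finset.sum_add_distrib]
  refine Finset.sum_le_sum fun b _ => ?_
  change ∑ a ∈ S.part b (m.size (σ b)), f a ≤ _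
  by_cases hm : m.size (σ b) = j
  · by_cases hc : c.size b = 0
    · simp [hm, hc]
    · simpa [hm, hc] using part_le b j
  · simpa [hm] using (part_le b (m.size (σ b))).trans le_self_add

theorem sum_extensions_sum_fresh (F : Equiv.Perm (Fin U) → q.Answer → ℝ≥0∞) :
    ∑ σ ∈ m.extensions c, ∑ b ∈ c.fresh with m.size (σ b) = j, ∑ a ∈ S.part b j, F σ a =
      ∑ b ∈ c.fresh, ∑ a ∈ S.part b j, ∑ σ ∈ m.extensions (c.reveal b hj), F σ a := by
  simp only [Finset.sum_filter]
  rw [Finset.sum_comm]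
  refine Finset.sum_congr rfl fun b hb => ?_
  rw [m.extensions_reveal c hb hj, ← Finset.sum_filter, Finset.sum_comm]

theorem inv_mul_card_extensions_reveal_le (hS : S.MostlyFresh m j Q η) {b : Fin U}
    (hb : b ∈ c.fresh) :
    ((∑ b, S.weight (m.size b) : ℕ) : ℝ≥0∞)⁻¹ * (m.extensions (c.reveal b hj)).card ≤
      (m.extensions c).card * ((S.weight j * c.fresh.card : ℕ) : ℝ≥0∞)⁻¹ := by
  have hle : (m.extensions (c.reveal b hj)).card * (S.weight j * c.fresh.card) ≤
      (m.extensions c).card * ∑ b, S.weight (m.size b) := by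
    calc (m.extensions (c.reveal b hj)).card * (S.weight j * c.fresh.card)
        = c.fresh.card * ((m.extensions c).filter fun σ => m.size (σ b) = j).card *
            S.weight j := by rw [m.extensions_reveal c hb hj]; ring
      _ ≤ (m.extensions c).card * (Finset.univ.filter fun b => m.size b = j).card *
            S.weight j :=
          Nat.mul_le_mul_right _ (m.card_fresh_mul_card_filter_le c (m.size · = j) hb)
      _ ≤ (m.extensions c).card * ∑ b, S.weight (m.size b) := by
          rw [mul_assoc]
          exact Nat.mul_le_mul_left _ (S.card_mul_weight_le m)
  have hfresh : 0 < S.weight j * c.fresh.card :=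
    Nat.mul_pos hS.weight_pos (Finset.card_pos.2 ⟨b, hb⟩)
  have htotal : 0 < ∑ b, S.weight (m.size b) := by
    obtain ⟨b, hb⟩ := hS.exists_size_eq
    refine hS.weight_pos.trans_le (hb ▸ ?_)
    exact Finset.single_le_sum_of_canonicallyOrdered (f := fun b => S.weight (m.size b))
      (Finset.mem_univ b)
  rw [← ENNReal.div_eq_inv_mul, ← div_eq_mul_inv,
    ENNReal.div_le_iff (Nat.cast_ne_zero.2 htotal.ne') (ENNReal.natCast_ne_top _),
    ← ENNReal.mul_div_right_comm,
    ENNReal.le_div_iff_mul_le (.inl (Nat.cast_ne_zero.2 hfresh.ne'))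
      (.inl (ENNReal.natCast_ne_top _))]
  exact_mod_cast hle

theorem mean_answer_permute_le (hS : S.MostlyFresh m j Q η) (hc : c.revealed.card ≤ Q)
    (σ : Equiv.Perm (Fin U)) {f : q.Answer → ℝ≥0∞} (hf : ∀ a, f a ≤ 1) :
    mean ((m.permute σ).toGraph.answer q) f ≤
      ((∑ b, S.weight (m.size b) : ℕ) : ℝ≥0∞)⁻¹ *
        ∑ b ∈ c.fresh with m.size (σ b) = j, ∑ a ∈ S.part b j, f a + η := by
  rw [S.mean_answer, m.sum_size_permute S.weight]
  set W : ℝ≥0∞ := ((∑ b, S.weight (m.size b) : ℕ) : ℝ≥0∞)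
  set main := ∑ b ∈ c.fresh with m.size (σ b) = j, ∑ a ∈ S.part b j, f a
  have sum_le : ∑ b : Fin U, ∑ a ∈ S.part b ((m.permute σ).size b), f a ≤ main + η * W := by
    refine (S.sum_part_permute_le m c σ hf).trans (add_le_add_right (le_trans ?_ hS.sum_le) _)
    exact Nat.cast_le.2 (by gcongr)
  calc W⁻¹ * ∑ b : Fin U, ∑ a ∈ S.part b ((m.permute σ).size b), f a
      ≤ W⁻¹ * (main + η * W) := by gcongr
    _ = W⁻¹ * main + η * (W⁻¹ * W) := by ring
    _ ≤ W⁻¹ * main + η := by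
        gcongr
        exact mul_le_of_le_one_right' (ENNReal.inv_mul_le_one _)

theorem sum_mean_answer_le (hS : S.MostlyFresh m j Q η) (hc : c.revealed.card ≤ Q)
    {F : Equiv.Perm (Fin U) → q.Answer → ℝ≥0∞} (hF : ∀ σ a, F σ a ≤ 1)
    {f : q.Answer → CliqueUnion U → ℝ≥0∞}
    (h : ∀ (a : q.Answer) (b : Fin U), ∑ σ ∈ m.extensions (c.reveal b hj), F σ a ≤
      (m.extensions (c.reveal b hj)).card * f a (c.reveal b hj)) :
    ∑ σ ∈ m.extensions c, mean ((m.permute σ).toGraph.answer q) (F σ) ≤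
      (m.extensions c).card * (S.simMean c hj f + η) := by
  set W : ℝ≥0∞ := ((∑ b, S.weight (m.size b) : ℕ) : ℝ≥0∞)
  calc ∑ σ ∈ m.extensions c, mean ((m.permute σ).toGraph.answer q) (F σ)
      ≤ ∑ σ ∈ m.extensions c,
          (W⁻¹ * ∑ b ∈ c.fresh with m.size (σ b) = j, ∑ a ∈ S.part b j, F σ a + η) :=
        Finset.sum_le_sum fun σ _ => S.mean_answer_permute_le m c hS hc σ (hF σ)
    _ = W⁻¹ * ∑ b ∈ c.fresh, ∑ a ∈ S.part b j, ∑ σ ∈ m.extensions (c.reveal b hj), F σ a +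
          (m.extensions c).card * η := by
        rw [Finset.sum_add_distrib, ← Finset.mul_sum, S.sum_extensions_sum_fresh m c hj,
          Finset.sum_const, nsmul_eq_mul]
    _ ≤ W⁻¹ * ∑ b ∈ c.fresh, ∑ a ∈ S.part b j,
          (m.extensions (c.reveal b hj)).card * f a (c.reveal b hj) +
          (m.extensions c).card * η := by
        gcongr
        exact h _ _
    _ ≤ (m.extensions c).card * S.simMean c hj f + (m.extensions c).card * η := by
        gcongr ?_ + _
        rw [simMean, ← mul_assoc, Finset.mul_sum, Finset.mul_sum]
        refine Finset.sum_le_sum fun b hb => ?_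
        rw [← Finset.mul_sum, ← mul_assoc]
        exact mul_le_mul_left (S.inv_mul_card_extensions_reveal_le m c hj hS hb) _
    _ = (m.extensions c).card * (S.simMean c hj f + η) := (mul_add _ _ _).symm

end BlockSampling

section LocalQueries

variable {U : ℕ} (m c : CliqueUnion U) {Q : ℕ} {η : ℝ≥0∞}

/-- A block that has not been seen so far is empty, up to probability `η`. -/
structure CliqueUnion.Sparse (m : CliqueUnion U) (Q : ℕ) (η : ℝ≥0∞) : Prop where
  lt : Q < U
  card_revealed_le : (m.revealed.card : ℝ≥0∞) ≤ η * (U - Q : ℕ)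

/-- The extensions of `c` with a clique in a fresh block of `B`. -/
def CliqueUnion.surprises (B : Finset (Fin U)) : Finset (Equiv.Perm (Fin U)) :=
  (m.extensions c).filter fun σ => ∃ b ∈ B, b ∈ c.fresh ∧ m.size (σ b) ≠ 0

theorem CliqueUnion.surprises_subset (B : Finset (Fin U)) : m.surprises c B ⊆ m.extensions c :=
  Finset.filter_subset _ _

variable {m} in
theorem CliqueUnion.Sparse.card_surprises_le (hm : m.Sparse Q η) (hc : c.revealed.card ≤ Q)
    (B : Finset (Fin U)) :
    ((m.surprises c B).card : ℝ≥0∞) ≤ (m.extensions c).card * (B.card * η) := by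
  have card_fresh_ge : U - Q ≤ c.fresh.card := by rw [c.card_fresh]; omega
  have card_filter_le (b) (hb : b ∈ c.fresh) :
      (((m.extensions c).filter fun σ => m.size (σ b) ≠ 0).card : ℝ≥0∞) ≤
        (m.extensions c).card * η := by
    have hpos : ((U - Q : ℕ) : ℝ≥0∞) ≠ 0 := Nat.cast_ne_zero.2 (Nat.sub_pos_of_lt hm.lt).ne'
    rw [← ENNReal.mul_le_mul_iff_right hpos (ENNReal.natCast_ne_top _)]
    calc ((U - Q : ℕ) : ℝ≥0∞) * ((m.extensions c).filter fun σ => m.size (σ b) ≠ 0).card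
        ≤ c.fresh.card * ((m.extensions c).filter fun σ => m.size (σ b) ≠ 0).card := by gcongr
      _ ≤ (m.extensions c).card * m.revealed.card := by
          exact_mod_cast m.card_fresh_mul_card_filter_le c (m.size · ≠ 0) hb
      _ ≤ (m.extensions c).card * (η * (U - Q : ℕ)) := by
          gcongr
          exact hm.card_revealed_le
      _ = _ := by ring
  have subset_biUnion : m.surprises c B ⊆ (B.filter (· ∈ c.fresh)).biUnion fun b =>
      (m.extensions c).filter fun σ => m.size (σ b) ≠ 0 := by
    intro σ hσ
    obtain ⟨hσ, b, hbB, hb, hne⟩ := Finset.mem_filter.1 hσ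
    exact Finset.mem_biUnion.2
      ⟨b, Finset.mem_filter.2 ⟨hbB, hb⟩, Finset.mem_filter.2 ⟨hσ, hne⟩⟩
  calc ((m.surprises c B).card : ℝ≥0∞)
      ≤ ∑ b ∈ B with b ∈ c.fresh,
          (((m.extensions c).filter fun σ => m.size (σ b) ≠ 0).card : ℝ≥0∞) := by
        exact_mod_cast (Finset.card_le_card subset_biUnion).trans Finset.card_biUnion_le
    _ ≤ ∑ _b ∈ B with _b ∈ c.fresh, (m.extensions c).card * η :=
        Finset.sum_le_sum fun b hb => card_filter_le b (Finset.mem_filter.1 hb).2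
    _ ≤ ∑ _b ∈ B, (m.extensions c).card * η :=
        Finset.sum_le_sum_of_subset (Finset.filter_subset _ _)
    _ = (m.extensions c).card * (B.card * η) := by
        rw [Finset.sum_const, nsmul_eq_mul]
        ring

theorem CliqueUnion.answer_permute_eq {q : Query} (hV : q ≠ .randVert) (hE : q ≠ .randEdge)
    {σ : Equiv.Perm (Fin U)} (hσ : σ ∈ m.extensions c) (hs : σ ∉ m.surprises c (q.blocks U)) :
    (m.permute σ).toGraph.answer q = c.toGraph.answer q := by
  refine answer_congr hV hE fun b hb => ?_
  by_cases hc : c.size b = 0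
  · rw [hc]
    by_contra hne
    exact hs (Finset.mem_filter.2 ⟨hσ, b, hb, c.mem_fresh.2 hc, hne⟩)
  · exact (m.mem_extensions c).1 hσ b hc

theorem CliqueUnion.sum_mean_answer_le {q : Query} (hV : q ≠ .randVert) (hE : q ≠ .randEdge)
    (hm : m.Sparse Q η) (hc : c.revealed.card ≤ Q)
    {F : Equiv.Perm (Fin U) → q.Answer → ℝ≥0∞} (hF : ∀ σ a, F σ a ≤ 1)
    {f : q.Answer → ℝ≥0∞} (h : ∀ a, ∑ σ ∈ m.extensions c, F σ a ≤ (m.extensions c).card * f a) :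
    ∑ σ ∈ m.extensions c, mean ((m.permute σ).toGraph.answer q) (F σ) ≤
      (m.extensions c).card * (mean (c.toGraph.answer q) f + q.cost * η) := by
  classical
  have mean_le (σ) (hσ : σ ∈ m.extensions c) :
      mean ((m.permute σ).toGraph.answer q) (F σ) ≤
        mean (c.toGraph.answer q) (F σ) + if σ ∈ m.surprises c (q.blocks U) then 1 else 0 := by
    split_ifs with hs
    · exact ((mean_mono _ (hF σ)).trans (mean_const _ 1).le).trans le_add_self
    · rw [m.answer_permute_eq c hV hE hσ hs, add_zero]
  calc ∑ σ ∈ m.extensions c, mean ((m.permute σ).toGraph.answer q) (F σ)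
      ≤ ∑ σ ∈ m.extensions c, (mean (c.toGraph.answer q) (F σ) +
          if σ ∈ m.surprises c (q.blocks U) then 1 else 0) := Finset.sum_le_sum mean_le
    _ = mean (c.toGraph.answer q) (fun a => ∑ σ ∈ m.extensions c, F σ a) +
          (m.surprises c (q.blocks U)).card := by
        rw [Finset.sum_add_distrib, mean_sum, Finset.sum_boole,
          Finset.filter_mem_eq_inter, Finset.inter_eq_right.2 (m.surprises_subset c _)]
    _ ≤ (m.extensions c).card * mean (c.toGraph.answer q) f +
          (m.extensions c).card * (q.cost * η) := by
        rw [← mean_const_mul]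
        refine add_le_add (mean_mono _ h) ((hm.card_surprises_le c hc _).trans ?_)
        gcongr
        exact q.card_blocks_le U
    _ = (m.extensions c).card * (mean (c.toGraph.answer q) f + q.cost * η) := (mul_add _ _ _).symm

end LocalQueries

section Simulation

variable {M : Set Query} {U s : ℕ} (hs : 1 < s)

/-- The expectation over the simulated answer to a query and the updated knowledge: a random
vertex is taken from a fresh pair, a random edge from a fresh clique of size `s`, and the other
queries are answered as if `c` were the input. -/
def simMean : (q : Query) → CliqueUnion U → (q.Answer → CliqueUnion U → ℝ≥0∞) → ℝ≥0∞
  | .randVert, c, f => vertSampling.simMean c one_lt_two f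
  | .randEdge, c, f => edgeSampling.simMean c hs f
  | q, c, f => mean (c.toGraph.answer q) fun a => f a c

open Classical in
/-- The probability that the algorithm, with the simulated oracle and initial knowledge `c`,
outputs an element of `T` at cost at most `b`. -/
def simProb (T : Set ℝ) : Alg M → ℕ → CliqueUnion U → ℝ≥0∞
  | .ret r, _, _ => if r ∈ T then 1 else 0
  | .toss p k, b, c => mean p fun i => simProb T (k i) b c
  | .query q _ k, b, c =>
      if q.cost ≤ b then simMean hs q c fun a => simProb T (k a) (b - q.cost) else 0

theorem simMean_eq_mean {q : Query} (hV : q ≠ .randVert) (hE : q ≠ .randEdge) (c : CliqueUnion U)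
    (f : q.Answer → CliqueUnion U → ℝ≥0∞) :
    simMean hs q c f = mean (c.toGraph.answer q) fun a => f a c := by
  cases q with
  | randVert => exact absurd rfl hV
  | randEdge => exact absurd rfl hE
  | _ => rfl

theorem simMean_add (q : Query) (c : CliqueUnion U) (f g : q.Answer → CliqueUnion U → ℝ≥0∞) :
    simMean hs q c (fun a d => f a d + g a d) = simMean hs q c f + simMean hs q c g := by
  cases q with
  | randVert => exact vertSampling.simMean_add c one_lt_two f g
  | randEdge => exact edgeSampling.simMean_add c hs f g
  | _ => exact mean_add _ _ _

theorem simMean_mono (q : Query) (c : CliqueUnion U) {f g : q.Answer → CliqueUnion U → ℝ≥0∞}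
    (h : ∀ a d, f a d ≤ g a d) : simMean hs q c f ≤ simMean hs q c g := by
  cases q with
  | randVert => exact vertSampling.simMean_mono c one_lt_two h
  | randEdge => exact edgeSampling.simMean_mono c hs h
  | _ => exact mean_mono _ fun a => h a c

theorem simMean_const_le (q : Query) (c : CliqueUnion U) (r : ℝ≥0∞) :
    simMean hs q c (fun _ _ => r) ≤ r := by
  cases q with
  | randVert => exact vertSampling.simMean_const_le c one_lt_two r
  | randEdge => exact edgeSampling.simMean_const_le c hs r
  | _ => exact (mean_const _ r).le

theorem simProb_query_add (T : Set ℝ) (q : Query) (hq : q ∈ M) (k : q.Answer → Alg M) (b : ℕ)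
    (c : CliqueUnion U) : simProb hs T (.query q hq k) (b + q.cost) c =
      simMean hs q c fun a => simProb hs T (k a) b := by
  simp only [simProb, Nat.le_add_left, if_true, Nat.add_sub_cancel]

theorem simProb_add_le_one {T T' : Set ℝ} (h : Disjoint T T') (A : Alg M) (b : ℕ)
    (c : CliqueUnion U) : simProb hs T A b c + simProb hs T' A b c ≤ 1 := by
  induction A generalizing b c with
  | ret r =>
    simp only [simProb]
    split_ifs with h1 h2
    · exact absurd h2 (Set.disjoint_left.1 h h1)
    all_goals simp
  | toss p k ih =>
    simp only [simProb, ← mean_add]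
    exact (mean_mono p fun i => ih i b c).trans (mean_const p 1).le
  | query q hq k ih =>
    simp only [simProb]
    split_ifs
    · rw [← simMean_add]
      exact (simMean_mono hs q c fun a d => ih a _ d).trans (simMean_const_le hs q c 1)
    · simp

end Simulation

section InitialKnowledge

variable {U : ℕ}

/-- The knowledge that the block `b` contains a clique of size `j`. -/
def CliqueUnion.single (b : Fin U) {j : ℕ} (hj : 1 < j) : CliqueUnion U where
  size := Pi.single b j
  size_ne_one b' := by rw [Pi.single_apply]; split_ifs <;> omega
  exists_size_ne_zero := ⟨b, by rw [Pi.single_eq_same]; omega⟩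

theorem CliqueUnion.size_single_of_ne {b b' : Fin U} {j : ℕ} (hj : 1 < j) (h : b' ≠ b) :
    (single b hj).size b' = 0 :=
  Pi.single_eq_of_ne (M := fun _ => ℕ) h j

theorem CliqueUnion.card_revealed_single (b : Fin U) {j : ℕ} (hj : 1 < j) :
    (single b hj).revealed.card ≤ 1 := by
  refine (Finset.card_le_card fun b' hb' => Finset.mem_singleton.2 ?_).trans
    (Finset.card_singleton b).le
  by_contra hne
  exact (mem_revealed _).1 hb' (size_single_of_ne hj hne)

theorem CliqueUnion.one_mem_extensions_single {m : CliqueUnion U} {b : Fin U} {j : ℕ}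
    (hj : 1 < j) (hb : m.size b = j) : 1 ∈ m.extensions (single b hj) := by
  refine (m.mem_extensions _).2 fun b' hb' => ?_
  obtain rfl : b' = b := by
    by_contra hne
    exact hb' (size_single_of_ne hj hne)
  rw [Equiv.Perm.one_apply, hb]
  exact (Pi.single_eq_same (M := fun _ => ℕ) b' j).symm

end InitialKnowledge

section Indistinguishability

variable {M : Set Query} {U s : ℕ} (hs : 1 < s) (T : Set ℝ) {m : CliqueUnion U} {Q : ℕ} {η : ℝ≥0∞}

/-- After the blocks of at most `Q` cliques have been seen, the simulated oracle errs on a random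
permutation of `m` with probability at most `η` per unit of cost. -/
structure CliqueUnion.Simulated (m : CliqueUnion U) (s Q : ℕ) (η : ℝ≥0∞) : Prop where
  vert : vertSampling.MostlyFresh m 2 Q η
  edge : edgeSampling.MostlyFresh m s Q η
  sparse : m.Sparse Q η

theorem CliqueUnion.Simulated.sum_mean_answer_le (hm : m.Simulated s Q η) {c : CliqueUnion U}
    (hc : c.revealed.card ≤ Q) (q : Query) {F : Equiv.Perm (Fin U) → q.Answer → ℝ≥0∞}
    (hF : ∀ σ a, F σ a ≤ 1) {f : q.Answer → CliqueUnion U → ℝ≥0∞}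
    (h : ∀ a (d : CliqueUnion U), d.revealed.card ≤ c.revealed.card + q.cost →
      ∑ σ ∈ m.extensions d, F σ a ≤ (m.extensions d).card * f a d) :
    ∑ σ ∈ m.extensions c, mean ((m.permute σ).toGraph.answer q) (F σ) ≤
      (m.extensions c).card * (simMean hs q c f + q.cost * η) := by
  have cost_randVert : (Query.randVert.cost : ℝ≥0∞) = 1 := Nat.cast_one
  have cost_randEdge : (Query.randEdge.cost : ℝ≥0∞) = 1 := Nat.cast_one
  by_cases hV : q = .randVert
  · subst hV
    rw [cost_randVert, one_mul]
    exact vertSampling.sum_mean_answer_le m c one_lt_two hm.vert hc hF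
      fun a b => h a _ (c.card_revealed_reveal_le b _)
  by_cases hE : q = .randEdge
  · subst hE
    rw [cost_randEdge, one_mul]
    exact edgeSampling.sum_mean_answer_le m c hs hm.edge hc hF
      fun a b => h a _ (c.card_revealed_reveal_le b _)
  rw [simMean_eq_mean hs hV hE]
  exact m.sum_mean_answer_le c hV hE hm.sparse hc hF fun a => h a c (Nat.le_add_right _ _)

theorem CliqueUnion.Simulated.sum_hitProb_le (hm : m.Simulated s Q η) (A : Alg M) {b : ℕ}
    {c : CliqueUnion U} (hc : c.revealed.card + b ≤ Q) :
    ∑ σ ∈ m.extensions c, hitProb (m.permute σ).toGraph T A b ≤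
      (m.extensions c).card * (simProb hs T A b c + b * η) := by
  induction A generalizing b c with
  | ret r =>
    simp only [hitProb_ret, simProb, Finset.sum_const, nsmul_eq_mul]
    gcongr
    exact le_self_add
  | toss p k ih =>
    calc ∑ σ ∈ m.extensions c, hitProb (m.permute σ).toGraph T (.toss p k) b
        = mean p fun i => ∑ σ ∈ m.extensions c, hitProb (m.permute σ).toGraph T (k i) b := by
          simp only [hitProb_toss, mean_sum]
      _ ≤ mean p fun i => (m.extensions c).card * (simProb hs T (k i) b c + b * η) :=
          mean_mono p fun i => ih i hc
      _ = (m.extensions c).card * (simProb hs T (.toss p k) b c + b * η) := by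
          rw [mean_const_mul, mean_add, mean_const]
          rfl
  | query q hq k ih =>
    rcases lt_or_ge b q.cost with hb | hb
    · simp only [hitProb_query_of_lt _ T q hq k hb, Finset.sum_const_zero, zero_le]
    obtain ⟨b, rfl⟩ := Nat.exists_eq_add_of_le' hb
    calc ∑ σ ∈ m.extensions c, hitProb (m.permute σ).toGraph T (.query q hq k) (b + q.cost)
        = ∑ σ ∈ m.extensions c, mean ((m.permute σ).toGraph.answer q) fun a =>
            hitProb (m.permute σ).toGraph T (k a) b := by
          simp only [hitProb_query_add]
      _ ≤ (m.extensions c).card *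
            (simMean hs q c (fun a d => simProb hs T (k a) b d + b * η) + q.cost * η) :=
          hm.sum_mean_answer_le hs (by omega) q (fun σ a => hitProb_le_one _ T (k a) b)
            fun a d hd => ih a (by omega)
      _ ≤ (m.extensions c).card *
            (simMean hs q c (fun a => simProb hs T (k a) b) + b * η + q.cost * η) := by
          rw [simMean_add]
          gcongr
          exact simMean_const_le hs q c _
      _ = (m.extensions c).card *
            (simProb hs T (.query q hq k) (b + q.cost) c + (b + q.cost : ℕ) * η) := by
          rw [simProb_query_add]
          push_cast
          ring

theorem CliqueUnion.Simulated.le_simProb_add (hm : m.Simulated s Q η) (A : Alg M) {b : ℕ}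
    (hb : b < Q) {b₀ : Fin U} (hb₀ : m.size b₀ = 2) {p : ℝ≥0∞}
    (hp : ∀ σ, p ≤ hitProb (m.permute σ).toGraph T A b) :
    p ≤ simProb hs T A b (single b₀ one_lt_two) + b * η := by
  set c := single b₀ one_lt_two
  have hne : ((m.extensions c).card : ℝ≥0∞) ≠ 0 :=
    Nat.cast_ne_zero.2 (Finset.card_ne_zero_of_mem (one_mem_extensions_single one_lt_two hb₀))
  rw [← ENNReal.mul_le_mul_iff_right hne (ENNReal.natCast_ne_top _)]
  calc ((m.extensions c).card : ℝ≥0∞) * p = ∑ _σ ∈ m.extensions c, p := by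
        rw [Finset.sum_const, nsmul_eq_mul]
    _ ≤ ∑ σ ∈ m.extensions c, hitProb (m.permute σ).toGraph T A b :=
        Finset.sum_le_sum fun σ _ => hp σ
    _ ≤ (m.extensions c).card * (simProb hs T A b c + b * η) := by
        have : c.revealed.card ≤ 1 := card_revealed_single b₀ one_lt_two
        exact hm.sum_hitProb_le hs T A (by omega)

/-- Two inputs whose random permutations look like the same simulated oracle cannot be told
apart. -/
theorem add_le_one_add {T T' : Set ℝ} (hT : Disjoint T T') {m' : CliqueUnion U}
    (hm : m.Simulated s Q η) (hm' : m'.Simulated s Q η) {b₀ : Fin U} (hb₀ : m.size b₀ = 2)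
    (hb₀' : m'.size b₀ = 2) (A : Alg M) {b : ℕ} (hb : b < Q) {p : ℝ≥0∞}
    (hp : ∀ σ, p ≤ hitProb (m.permute σ).toGraph T A b)
    (hp' : ∀ σ, p ≤ hitProb (m'.permute σ).toGraph T' A b) : p + p ≤ 1 + 2 * (b * η) := by
  have hs : 1 < s := not_le.1 fun h => hm.edge.weight_pos.ne' (Nat.choose_eq_zero_of_lt (by omega))
  set c := CliqueUnion.single b₀ one_lt_two
  calc p + p
      ≤ (simProb hs T A b c + b * η) + (simProb hs T' A b c + b * η) :=
        add_le_add (hm.le_simProb_add hs T A hb hb₀ hp) (hm'.le_simProb_add hs T' A hb hb₀' hp')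
    _ = (simProb hs T A b c + simProb hs T' A b c) + 2 * (b * η) := by ring
    _ ≤ 1 + 2 * (b * η) := by
        gcongr
        exact simProb_add_le_one hs hT A b c

end Indistinguishability

section Templates

variable {U l k s : ℕ} (hl : 0 < l) (hU : l + k ≤ U) (hs : 1 < s)

/-- The union of `l` cliques with two vertices and `k` cliques with `s` vertices. -/
def CliqueUnion.mixed : CliqueUnion U where
  size b := if (b : ℕ) < l then 2 else if (b : ℕ) < l + k then s else 0
  size_ne_one b := by split_ifs <;> omega
  exists_size_ne_zero := ⟨⟨0, by omega⟩, by simp [hl]⟩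

theorem CliqueUnion.sum_size_mixed {M : Type*} [Semiring M] (F : ℕ → M) (hF : F 0 = 0) :
    ∑ b, F ((mixed hl hU hs).size b) = l * F 2 + k * F s := by
  obtain ⟨t, rfl⟩ := Nat.exists_eq_add_of_le hU
  have sum_range := Fin.sum_univ_eq_sum_range
    (fun i => F (if i < l then 2 else if i < l + k then s else 0)) (l + k + t)
  refine sum_range.trans ?_
  have sum_pairs : ∑ i ∈ Finset.range l, F (if i < l then 2 else if i < l + k then s else 0) =
      l * F 2 := by
    rw [Finset.sum_congr rfl fun i hi => by rw [if_pos (Finset.mem_range.1 hi)],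
      Finset.sum_const, Finset.card_range, nsmul_eq_mul]
  have sum_large : ∑ i ∈ Finset.range k,
      F (if l + i < l then 2 else if l + i < l + k then s else 0) = k * F s := by
    rw [Finset.sum_congr rfl fun i hi => by
        rw [if_neg (by omega), if_pos (by have := Finset.mem_range.1 hi; omega)],
      Finset.sum_const, Finset.card_range, nsmul_eq_mul]
  have sum_empty : ∑ i ∈ Finset.range t,
      F (if l + k + i < l then 2 else if l + k + i < l + k then s else 0) = 0 :=
    Finset.sum_eq_zero fun i _ => by rw [if_neg (by omega), if_neg (by omega), hF]
  rw [Finset.sum_range_add, Finset.sum_range_add, sum_pairs, sum_large, sum_empty, add_zero]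

theorem CliqueUnion.card_revealed_mixed : (mixed hl hU hs).revealed.card = l + k := by
  rw [revealed, Finset.card_filter,
    sum_size_mixed hl hU hs (fun i => if i ≠ 0 then 1 else 0) (if_neg (not_not.2 rfl)),
    if_pos two_ne_zero, if_pos (by omega)]
  simp

theorem CliqueUnion.sum_filter_size_mixed {j : ℕ} {W : ℕ → ℕ} (hW : W 0 = 0) :
    ∑ b with (mixed hl hU hs).size b ≠ j, W ((mixed hl hU hs).size b) =
      l * (if 2 ≠ j then W 2 else 0) + k * (if s ≠ j then W s else 0) := by
  rw [Finset.sum_filter]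
  refine (sum_size_mixed hl hU hs (fun i => if i ≠ j then W i else 0) ?_)
  rw [hW, ite_self]

theorem CliqueUnion.simulated_mixed (hs2 : s ≠ 2) (hk : 0 < k) {Q : ℕ} {η : ℝ≥0∞}
    (hV : ((s * k + Q * 2 : ℕ) : ℝ≥0∞) ≤ η * (2 * l + s * k : ℕ))
    (hE : ((l + Q * s.choose 2 : ℕ) : ℝ≥0∞) ≤ η * (l + s.choose 2 * k : ℕ))
    (hQ : Q < U) (hR : ((l + k : ℕ) : ℝ≥0∞) ≤ η * (U - Q : ℕ)) :
    (mixed hl hU hs).Simulated s Q η where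
  vert :=
    { weight_pos := two_pos
      exists_size_eq := ⟨⟨0, by omega⟩, if_pos hl⟩
      sum_le := by
        rw [sum_filter_size_mixed hl hU hs rfl, sum_size_mixed hl hU hs vertSampling.weight rfl,
          if_neg (not_not.2 rfl), if_pos hs2]
        convert hV using 3 <;> simp only [vertSampling, Nat.cast_id] <;> ring }
  edge :=
    { weight_pos := Nat.choose_pos hs
      exists_size_eq := ⟨⟨l, by omega⟩, by simp [mixed, hk]⟩
      sum_le := by
        rw [sum_filter_size_mixed hl hU hs rfl, sum_size_mixed hl hU hs edgeSampling.weight rfl,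
          if_neg (not_not.2 rfl), if_pos hs2.symm]
        convert hE using 3 <;> simp only [edgeSampling, Nat.cast_id, Nat.choose_self] <;> ring }
  sparse :=
    { lt := hQ
      card_revealed_le := by rwa [card_revealed_mixed] }

theorem CliqueUnion.n_permute (m : CliqueUnion U) (σ : Equiv.Perm (Fin U)) :
    (m.permute σ).toGraph.n = m.toGraph.n := by
  rw [n_toGraph, n_toGraph, sum_size_permute m fun i => i]

theorem CliqueUnion.avgDeg_permute (m : CliqueUnion U) (σ : Equiv.Perm (Fin U)) :
    (m.permute σ).toGraph.avgDeg = m.toGraph.avgDeg := by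
  have card_edges_permute : (m.permute σ).toGraph.edges.card = m.toGraph.edges.card := by
    rw [card_edges_toGraph, card_edges_toGraph, sum_size_permute m fun i => i.choose 2]
  have hn : (m.toGraph.n : ℝ) ≠ 0 := Nat.cast_ne_zero.2 m.toGraph.n_pos.ne'
  have h := (m.permute σ).toGraph.two_mul_card_edges
  rw [card_edges_permute, n_permute, m.toGraph.two_mul_card_edges] at h
  exact (mul_left_cancel₀ hn h).symm

end Templates

section Scales

variable {r n a k : ℕ}

theorem natCast_le_div_mul {x y z : ℕ} (hr : r ≠ 0) (h : x * r ≤ z * y) :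
    (x : ℝ≥0∞) ≤ z / r * y := by
  rw [← ENNReal.mul_div_right_comm, ENNReal.le_div_iff_mul_le (by simp [hr]) (by simp)]
  exact_mod_cast h

theorem choose_two_two_mul_sq_add_one (r : ℕ) :
    (2 * r ^ 2 + 1).choose 2 = r ^ 2 * (2 * r ^ 2 + 1) := by
  rw [Nat.choose_two_right, Nat.add_sub_cancel]
  exact Nat.div_eq_of_eq_mul_left two_pos (by ring)

theorem two_mul_sq_add_one_mul_lt (hr : 1 < r) (hk : 0 < k) (hk' : k ≤ 3 * a * r ^ 2) :
    (2 * r ^ 2 + 1) * k < 9 * a * r ^ 4 :=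
  calc (2 * r ^ 2 + 1) * k < 3 * r ^ 2 * k := Nat.mul_lt_mul_of_pos_right (by nlinarith) hk
    _ ≤ 3 * r ^ 2 * (3 * a * r ^ 2) := Nat.mul_le_mul_left _ hk'
    _ = 9 * a * r ^ 4 := by ring

theorem mul_le_four_mul_edges {l : ℕ} (hl : 2 * l ≤ 32 * r ^ 5) (hk : 2 * r ^ 2 ≤ k) :
    l * r ≤ 4 * (r ^ 2 * (2 * r ^ 2 + 1) * k) :=
  calc l * r ≤ 16 * r ^ 5 * r := Nat.mul_le_mul_right _ (by omega)
    _ = 4 * (r ^ 2 * (2 * r ^ 2) * (2 * r ^ 2)) := by ring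
    _ ≤ 4 * (r ^ 2 * (2 * r ^ 2 + 1) * k) := by
        gcongr
        exact Nat.le_succ _

theorem CliqueUnion.simulated_mixed_of_scale {l : ℕ} (ha : 0 < a) (hr : 9 * a ≤ r)
    (hn : r ^ 5 ≤ n) (hn' : n ≤ 32 * r ^ 5) (hk : 2 * r ^ 2 ≤ k) (hk' : k ≤ 3 * a * r ^ 2)
    (hl : n = 2 * l + (2 * r ^ 2 + 1) * k) (hl0 : 0 < l) (hU : l + k ≤ n * n + n + 1)
    (hs : 1 < 2 * r ^ 2 + 1) :
    (mixed hl0 hU hs).Simulated (2 * r ^ 2 + 1) r ((11 * a : ℕ) / r) := by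
  have hr0 : 0 < r := by omega
  have hk0 : 0 < k := (by positivity : 0 < 2 * r ^ 2).trans_le hk
  have r_le : r ≤ n := (Nat.le_self_pow (by norm_num) r).trans hn
  have := Nat.le_mul_self n
  refine simulated_mixed hl0 hU hs (by omega) hk0 (natCast_le_div_mul hr0.ne' ?_)
    (natCast_le_div_mul hr0.ne' ?_) (by omega) (natCast_le_div_mul hr0.ne' ?_)
  · calc ((2 * r ^ 2 + 1) * k + r * 2) * r ≤ (9 * a * r ^ 4 + r ^ 4 * (2 * a)) * r := by
          refine Nat.mul_le_mul_right r (Nat.add_le_add ?_ (Nat.mul_le_mul ?_ (by omega)))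
          · exact (two_mul_sq_add_one_mul_lt (by omega) hk0 hk').le
          · exact Nat.le_self_pow (by norm_num) r
      _ = 11 * a * r ^ 5 := by ring
      _ ≤ 11 * a * (2 * l + (2 * r ^ 2 + 1) * k) := Nat.mul_le_mul_left _ (hl ▸ hn)
  · rw [choose_two_two_mul_sq_add_one]
    set W := r ^ 2 * (2 * r ^ 2 + 1)
    calc (l + r * W) * r = l * r + W * r ^ 2 := by ring
      _ ≤ 4 * (W * k) + W * k :=
          Nat.add_le_add (mul_le_four_mul_edges (by omega) hk) (Nat.mul_le_mul_left W (by omega))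
      _ = 5 * (W * k) := by ring
      _ ≤ 11 * a * (l + W * k) := Nat.mul_le_mul (by omega) (Nat.le_add_left _ _)
  · have k_le : k ≤ (2 * r ^ 2 + 1) * k := Nat.le_mul_of_pos_left _ (by omega)
    calc (l + k) * r ≤ n * n := Nat.mul_le_mul (by omega) r_le
      _ ≤ 1 * (n * n + n + 1 - r) := by omega
      _ ≤ 11 * a * (n * n + n + 1 - r) := Nat.mul_le_mul_right _ (by omega)

/-- The hard inputs have about `r ^ 5` vertices, most of them in cliques of size two, and about
`r ^ 2` cliques of size about `r ^ 2`, which contain most of the edges. -/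
theorem CliqueUnion.exists_simulated (ha : 0 < a) (hr : 9 * a ≤ r) (hn : r ^ 5 ≤ n)
    (hn' : n ≤ 32 * r ^ 5) (hk : 2 * r ^ 2 ≤ k) (hk' : k ≤ 3 * a * r ^ 2)
    (hpar : k % 2 = n % 2) :
    ∃ m : CliqueUnion (n * n + n + 1), m.Simulated (2 * r ^ 2 + 1) r ((11 * a : ℕ) / r) ∧
      m.size 0 = 2 ∧ m.toGraph.n = n ∧
      r ^ 2 * (2 * r ^ 2 + 1) * k ≤ m.toGraph.edges.card ∧
      m.toGraph.edges.card ≤ r ^ 2 * (2 * r ^ 2 + 1) * (k + r ^ 2) := by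
  have hr0 : 0 < r := by omega
  have hk0 : 0 < k := (by positivity : 0 < 2 * r ^ 2).trans_le hk
  have hs : 1 < 2 * r ^ 2 + 1 := Nat.lt_add_of_pos_left (by positivity)
  have sk_lt : (2 * r ^ 2 + 1) * k < n :=
    calc (2 * r ^ 2 + 1) * k < 9 * a * r ^ 4 := two_mul_sq_add_one_mul_lt (by omega) hk0 hk'
      _ ≤ r * r ^ 4 := Nat.mul_le_mul_right _ hr
      _ = r ^ 5 := by ring
      _ ≤ n := hn
  have sk_mod : (2 * r ^ 2 + 1) * k % 2 = n % 2 := by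
    rw [Nat.mul_mod, hpar, show (2 * r ^ 2 + 1) % 2 = 1 by omega, one_mul, Nat.mod_mod]
  obtain ⟨l, hl⟩ : ∃ l, n = 2 * l + (2 * r ^ 2 + 1) * k :=
    ⟨(n - (2 * r ^ 2 + 1) * k) / 2, by omega⟩
  have hl0 : 0 < l := by omega
  have hU : l + k ≤ n * n + n + 1 := by
    have k_le : k ≤ (2 * r ^ 2 + 1) * k := Nat.le_mul_of_pos_left _ (by omega)
    omega
  refine ⟨mixed hl0 hU hs, simulated_mixed_of_scale ha hr hn hn' hk hk' hl hl0 hU hs,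
    if_pos hl0, ?_, ?_⟩
  · rw [n_toGraph, sum_size_mixed hl0 hU hs (fun i => i) rfl]
    simp only [Nat.cast_id]
    linarith
  · have card_edges : (mixed hl0 hU hs).toGraph.edges.card =
        l + r ^ 2 * (2 * r ^ 2 + 1) * k := by
      rw [card_edges_toGraph, sum_size_mixed hl0 hU hs (fun i => i.choose 2) rfl,
        choose_two_two_mul_sq_add_one, Nat.choose_self, Nat.cast_id, Nat.cast_id]
      ring
    have nine_mul_le : l * 9 ≤ 4 * (r ^ 2 * (2 * r ^ 2 + 1) * (2 * r ^ 2)) :=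
      (Nat.mul_le_mul_left l (by omega)).trans (mul_le_four_mul_edges (by omega) le_rfl)
    rw [card_edges]
    constructor <;> linarith

theorem disjoint_isApprox {c d d' : ℝ} (hc : 0 < c) (h : c ^ 2 * d < d') :
    Disjoint {y | IsApprox c d y} {y | IsApprox c d' y} := by
  refine Set.disjoint_left.2 fun y hy hy' => h.not_ge ?_
  calc d' ≤ y * c := (div_le_iff₀ hc).1 hy'.1
    _ ≤ c * d * c := by gcongr; exact hy.2
    _ = c ^ 2 * d := by ring

theorem sq_mul_avgDeg_lt {G H : Graph} {c : ℝ} (hn : G.n = H.n)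
    (h : c ^ 2 * G.edges.card < H.edges.card) : c ^ 2 * G.avgDeg < H.avgDeg := by
  have hpos : (0 : ℝ) < H.n := Nat.cast_pos.2 H.n_pos
  have hG := G.two_mul_card_edges
  have hH := H.two_mul_card_edges
  rw [hn] at hG
  refine lt_of_mul_lt_mul_left ?_ hpos.le
  calc (H.n : ℝ) * (c ^ 2 * G.avgDeg) = 2 * (c ^ 2 * G.edges.card) := by
        rw [mul_left_comm, ← hG, mul_left_comm]
    _ < 2 * (H.edges.card : ℝ) := by gcongr
    _ = H.n * H.avgDeg := hH

theorem add_le_one_add_of_approx {M : Set Query} {c : ℝ} (hc : 0 < c) (hac : 2 * c ^ 2 < a)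
    (hr : 9 * a ≤ r) (hn : r ^ 5 ≤ n) (hn' : n ≤ 32 * r ^ 5) (A : Alg M) {b : ℕ} (hb : b < r)
    {p : ℝ≥0∞} (hp : ∀ G : Graph, G.n = n → p ≤ hitProb G {y | IsApprox c G.avgDeg y} A b) :
    p + p ≤ 1 + 2 * (b * ((11 * a : ℕ) / r)) := by
  have ha : 0 < a := Nat.cast_pos.1 ((by positivity : 0 < 2 * c ^ 2).trans hac)
  have hr2 : 1 ≤ r ^ 2 := Nat.one_le_pow _ _ (by omega)
  have le_mul : r ^ 2 ≤ a * r ^ 2 := Nat.le_mul_of_pos_left _ ha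
  obtain ⟨m, hm, hm2, hmn, -, card_le⟩ := CliqueUnion.exists_simulated
    (k := 2 * r ^ 2 + n % 2) ha hr hn hn' (by omega) (by rw [mul_assoc]; omega) (by omega)
  obtain ⟨m', hm', hm2', hmn', le_card, -⟩ := CliqueUnion.exists_simulated
    (k := 2 * (a * r ^ 2) + n % 2) ha hr hn hn' (by omega) (by rw [mul_assoc]; omega) (by omega)
  have card_lt : c ^ 2 * m.toGraph.edges.card < m'.toGraph.edges.card := by
    set W := r ^ 2 * (2 * r ^ 2 + 1)
    have : 0 < W * r ^ 2 := by positivity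
    have card_le' : m.toGraph.edges.card ≤ W * (4 * r ^ 2) :=
      card_le.trans (Nat.mul_le_mul_left W (by omega))
    have le_card' : W * (2 * (a * r ^ 2)) ≤ m'.toGraph.edges.card :=
      (Nat.mul_le_mul_left W (Nat.le_add_right _ _)).trans le_card
    calc c ^ 2 * m.toGraph.edges.card ≤ c ^ 2 * (W * (4 * r ^ 2) : ℕ) := by gcongr
      _ = 2 * (2 * c ^ 2) * (W * r ^ 2 : ℕ) := by push_cast; ring
      _ < 2 * a * (W * r ^ 2 : ℕ) := by gcongr
      _ = (W * (2 * (a * r ^ 2)) : ℕ) := by push_cast; ring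
      _ ≤ m'.toGraph.edges.card := Nat.cast_le.2 le_card'
  have hp_permute {m : CliqueUnion (n * n + n + 1)} (hmn : m.toGraph.n = n) (σ) :
      p ≤ hitProb (m.permute σ).toGraph {y | IsApprox c m.toGraph.avgDeg y} A b := by
    rw [← m.avgDeg_permute σ]
    exact hp _ ((m.n_permute σ).trans hmn)
  exact add_le_one_add (disjoint_isApprox hc (sq_mul_avgDeg_lt (hmn.trans hmn'.symm) card_lt))
    hm hm' hm2 hm2' A hb (hp_permute hmn) (hp_permute hmn')

theorem lt_mul_of_approx {M : Set Query} {c : ℝ} (hc : 0 < c) (hac : 2 * c ^ 2 < a)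
    (hr : 9 * a ≤ r) (hn : r ^ 5 ≤ n) (hn' : n ≤ 32 * r ^ 5) (A : Alg M) {b K : ℕ} {p : ℝ≥0∞}
    (hK : (K : ℝ≥0∞)⁻¹ < p - 1 / 2)
    (hp : ∀ G : Graph, G.n = n → p ≤ hitProb G {y | IsApprox c G.avgDeg y} A b) :
    r < 11 * a * K * b := by
  by_contra! hb
  have ha : 0 < a := Nat.cast_pos.1 ((by positivity : 0 < 2 * c ^ 2).trans hac)
  have hr0 : 0 < r := by omega
  have hK0 : K ≠ 0 := by
    rintro rfl
    simp at hK
  have b_lt : b < r := by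
    have : 11 * b ≤ 11 * a * K * b :=
      Nat.mul_le_mul_right b (by rw [mul_assoc]; exact Nat.le_mul_of_pos_right 11 (by positivity))
    omega
  have error_le : b * ((11 * a : ℕ) / r : ℝ≥0∞) ≤ (K : ℝ≥0∞)⁻¹ := by
    rw [ENNReal.le_inv_iff_mul_le, ← mul_div_assoc, ← ENNReal.mul_div_right_comm]
    refine ENNReal.div_le_of_le_mul ?_
    rw [one_mul]
    exact_mod_cast (by linarith : b * (11 * a) * K ≤ r)
  have inv_add_half_lt : (K : ℝ≥0∞)⁻¹ + 1 / 2 < p := lt_tsub_iff_right.1 hK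
  refine (add_le_one_add_of_approx hc hac hr hn hn' A b_lt hp).not_gt ?_
  calc 1 + 2 * (b * ((11 * a : ℕ) / r : ℝ≥0∞)) ≤ (1 / 2 + 1 / 2) + 2 * (K : ℝ≥0∞)⁻¹ := by
        rw [ENNReal.add_halves]
        gcongr
    _ = ((K : ℝ≥0∞)⁻¹ + 1 / 2) + ((K : ℝ≥0∞)⁻¹ + 1 / 2) := by ring
    _ < p + p := ENNReal.add_lt_add inv_add_half_lt inv_add_half_lt

theorem exists_scale {N : ℕ} (hN : N ≠ 0) (hn : N ^ 5 ≤ n) :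
    ∃ r : ℕ, N ≤ r ∧ r ^ 5 ≤ n ∧ n ≤ 32 * r ^ 5 ∧ (n : ℝ) ^ (1 / 5 : ℝ) ≤ 2 * r := by
  set x : ℝ := (n : ℝ) ^ (1 / 5 : ℝ)
  have hx0 : 0 ≤ x := by positivity
  have hx5 : x ^ 5 = n := by
    rw [← Real.rpow_natCast, ← Real.rpow_mul (Nat.cast_nonneg n)]
    norm_num
  have N_le : N ≤ ⌊x⌋₊ := by
    refine Nat.le_floor (le_of_pow_le_pow_left₀ (n := 5) (by norm_num) hx0 ?_)
    rw [hx5]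
    exact_mod_cast hn
  have floor_le : (⌊x⌋₊ : ℝ) ≤ x := Nat.floor_le hx0
  have le_two_mul : x ≤ 2 * ⌊x⌋₊ := by
    have one_le : (1 : ℝ) ≤ ⌊x⌋₊ := by exact_mod_cast (Nat.one_le_iff_ne_zero.2 hN).trans N_le
    linarith [Nat.lt_floor_add_one x]
  refine ⟨⌊x⌋₊, N_le, ?_, ?_, le_two_mul⟩
  · have : (⌊x⌋₊ : ℝ) ^ 5 ≤ n := hx5 ▸ pow_le_pow_left₀ (Nat.cast_nonneg _) floor_le 5
    exact_mod_cast this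
  · have : (n : ℝ) ≤ 32 * ⌊x⌋₊ ^ 5 := by
      calc (n : ℝ) = x ^ 5 := hx5.symm
        _ ≤ (2 * ⌊x⌋₊) ^ 5 := by gcongr
        _ = 32 * ⌊x⌋₊ ^ 5 := by ring
    exact_mod_cast this

end Scales

theorem query_lower_bound (c : ℝ) (p : ℝ≥0∞) (hc : 1 ≤ c) (hp : 1 / 2 < p) :
    ∃ (κ : ℝ) (N : ℕ), 0 < κ ∧ ∀ n : ℕ, N ≤ n → ∀ (A : Alg fullNbrModel) (q : ℝ),
      (∀ G : Graph, G.n = n → p ≤ successProb A G c q) → κ * (n : ℝ) ^ (1 / 5 : ℝ) ≤ q := by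
  obtain ⟨K, hK⟩ := ENNReal.exists_inv_nat_lt (tsub_pos_of_lt hp).ne'
  obtain ⟨a, hac⟩ := exists_nat_gt (2 * c ^ 2)
  have hc0 : 0 < c := one_pos.trans_le hc
  have ha : 0 < a := Nat.cast_pos.1 ((by positivity : 0 < 2 * c ^ 2).trans hac)
  have hK0 : 0 < K := by
    refine Nat.pos_of_ne_zero ?_
    rintro rfl
    simp at hK
  refine ⟨((22 * a * K : ℕ) : ℝ)⁻¹, (9 * a) ^ 5, by positivity, fun n hn A q hA => ?_⟩
  obtain ⟨r, hr, hrn, hnr, hx⟩ := exists_scale (by positivity : 9 * a ≠ 0) hn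
  have r_lt : r < 11 * a * K * ⌊max q 0⌋₊ := by
    refine lt_mul_of_approx hc0 hac hr hrn hnr A hK fun G hG => ?_
    rw [← successProb_eq_hitProb G A c (le_max_right q 0)]
    exact (hA G hG).trans (successProb_mono G A c (le_max_left q 0))
  have floor_pos : 0 < ⌊max q 0⌋₊ := Nat.pos_of_ne_zero fun h => by simp [h] at r_lt
  have hq : 0 < q := by
    by_contra! h
    simp [max_eq_right h] at floor_pos
  rw [max_eq_left hq.le] at r_lt
  rw [inv_mul_le_iff₀ (by positivity)]
  calc (n : ℝ) ^ (1 / 5 : ℝ) ≤ 2 * r := hx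
    _ ≤ 2 * (11 * a * K * ⌊q⌋₊ : ℕ) := by gcongr
    _ = (22 * a * K : ℕ) * ⌊q⌋₊ := by push_cast; ring
    _ ≤ (22 * a * K : ℕ) * q := by gcongr; exact Nat.floor_le hq.le

end AvgDeg

end

theorem theorem1p2 :
    -- an algorithm with query cost `Õ(ε⁻² min(d, (n/d)^(1/4)))`
    (∃ (C : ℝ) (k : ℕ), ∀ (n : ℕ) (ε : ℝ), 0 < ε → ε < 1 →
      ∃ A : AvgDeg.Alg AvgDeg.advancedModel, ∀ G : AvgDeg.Graph, G.n = n →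
        99 / 100 < AvgDeg.successProb A G (1 + ε)
          (C * Real.log n ^ k * (ε⁻¹ ^ 2 *
            min G.avgDeg (((n : ℝ) / G.avgDeg) ^ (1 / 4 : ℝ))))) ∧
    -- in particular, an algorithm with query cost `Õ(ε⁻² n^(1/5))`
    (∃ (C : ℝ) (k : ℕ), ∀ (n : ℕ) (ε : ℝ), 0 < ε → ε < 1 →
      ∃ A : AvgDeg.Alg AvgDeg.advancedModel, ∀ G : AvgDeg.Graph, G.n = n →
        99 / 100 < AvgDeg.successProb A G (1 + ε)
          (C * Real.log n ^ k * (ε⁻¹ ^ 2 * (n : ℝ) ^ (1 / 5 : ℝ)))) ∧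
    -- constant factor approximation needs `Ω(n^(1/5))`, even with full neighbourhood access
    (∀ (c : ℝ) (p : ENNReal), 1 ≤ c → 1 / 2 < p →
      ∃ (κ : ℝ) (N : ℕ), 0 < κ ∧ ∀ n : ℕ, N ≤ n →
        ∀ (A : AvgDeg.Alg AvgDeg.fullNbrModel) (q : ℝ),
          (∀ G : AvgDeg.Graph, G.n = n → p ≤ AvgDeg.successProb A G c q) →
            κ * (n : ℝ) ^ (1 / 5 : ℝ) ≤ q) := by
  refine ⟨⟨10 ^ 19, 4, fun n ε hε0 hε1 =>
      ⟨AvgDeg.avgDegAlg n ε, AvgDeg.query_upper_bound hε0 hε1⟩⟩,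
    ⟨10 ^ 19, 4, fun n ε hε0 hε1 => ⟨AvgDeg.avgDegAlg n ε, fun G hG =>
      (AvgDeg.query_upper_bound hε0 hε1 G hG).trans_le (AvgDeg.successProb_mono G _ _ ?_)⟩⟩,
    AvgDeg.query_lower_bound⟩
  have := Real.log_natCast_nonneg n
  have hn : (0 : ℝ) < n := by rw [← hG]; exact_mod_cast G.n_pos
  gcongr
  exact AvgDeg.min_le_rpow hn (by linarith [G.one_le_avgDeg])
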